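/- (a) Let $K$ be a perfect field and let $\varphi\in K[x]$ be a polynomial whose derivative $\varphi'$ is not identically $0$. Let $\varphi^{\circ n}$ denote the $n$-fold iterate of $\varphi$, let $F=K(t)$ be the rational function field, and let $\mathcal F_\varphi$ be the field obtained by adjoining to $F$, inside a fixed algebraic closure of $F$, all roots of $\varphi^{\circ n}(x)-t$ for all $n$. The extension $\mathcal F_\varphi/F$ is finitely ramified (i.e. only finitely many places of $F/K$ ramify in $\mathcal F_\varphi$) if and only if $\varphi$ is post-critically finite, i.e. every zero $r\in\overline K$ of $\varphi'$ is preperiodic under $\varphi$. (b) Let $K$ be a number field and let $\varphi\in K[x]$ be a post-critically finite polynomial of degree $d\ge 1$ with leading coefficient $a$. Let $\mathcal P_\varphi=\{\varphi^{\circ n}(r): n\ge 0,\ r\in\overline K,\ \varphi'(r)=0\}$ be its post-critical set, and let $t_0\in K$. Let $\mathcal K_{\varphi,t_0}\subseteq\overline K$ be the specialization of $\mathcal F_\varphi$ at $t_0$, that is, the image of any $K$-algebra homomorphism with $t\mapsto t_0$ from the integral closure of $K[t]$ in $\mathcal F_\varphi$ to $\overline K$. Then $\mathcal K_{\varphi,t_0}/K$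 is finitely ramified: only finitely many (finite or infinite) places of $K$ ramify in it. Suppose moreover that $\varphi$ has coefficients in the ring of integers $\mathcal O_K$. Then $\mathcal K_{\varphi,t_0}/K$ is unramified outside the set $S_{\varphi,t_0}$ consisting of the real places of $K$ and of those finite places $v$ for which at least one of $d$, $a$, and the elements $t_0-\nu$ with $\nu\in\mathcal P_\varphi$ has non-zero (additive) valuation at $v$ (for $t_0-\nu$: at some extension of $v$ to $\overline K$). If $t_0\notin\mathcal P_\varphi$, then $S_{\varphi,t_0}$ is finite. -/

import Mathlib

open Polynomial IsDedekindDomain NumberField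

namespace IteratedTower

section Dynamics

/-- The `n`-fold iterate `φ^{∘n}` as a polynomial; `φ^{∘0} = x`. -/
noncomputable def iter {K : Type*} [Field K] (φ : K[X]) (n : ℕ) : K[X] := φ.comp^[n] X

/-- The self-map of the algebraic closure of `K` given by `φ`. -/
noncomputable def polyMap {K : Type*} [Field K] (φ : K[X]) :
    AlgebraicClosure K → AlgebraicClosure K := fun x => aeval x φ

/-- The affine critical points of `φ`: the zeros of `φ'` in the algebraic closure. -/
def critPoints {K : Type*} [Field K] (φ : K[X]) : Set (AlgebraicClosure K) :=
  {r | aeval r (derivative φ) = 0}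

/-- `y` is preperiodic for `φ`: some iterate of `φ` maps `y` to a periodic point. -/
def IsPreperiodic {K : Type*} [Field K] (φ : K[X]) (y : AlgebraicClosure K) : Prop :=
  ∃ m : ℕ, (polyMap φ)^[m] y ∈ Function.periodicPts (polyMap φ)

/-- `φ` is post-critically finite: every critical point is preperiodic. -/
def IsPCF {K : Type*} [Field K] (φ : K[X]) : Prop :=
  ∀ r ∈ critPoints φ, IsPreperiodic φ r

/-- The post-critical set: the union of the forward orbits of the critical points. -/
def postCritSet {K : Type*} [Field K] (φ : K[X]) : Set (AlgebraicClosure K) :=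
  {ν | ∃ r ∈ critPoints φ, ∃ n : ℕ, ν = (polyMap φ)^[n] r}

end Dynamics

section Tower

/-- `Φ_n(x,t) = φ^{∘n}(x) - t`, a polynomial in `x` over `F = K(t)`. -/
noncomputable def Phi {K : Type*} [Field K] (φ : K[X]) (n : ℕ) : (RatFunc K)[X] :=
  (iter φ n).map (algebraMap K (RatFunc K)) - C RatFunc.X

/-- `𝓕_φ`: the subfield of the algebraic closure of `F = K(t)` generated over `F` by all roots of
all `Φ_n(x,t)`. -/
noncomputable def towerField {K : Type*} [Field K] (φ : K[X]) :
    IntermediateField (RatFunc K) (AlgebraicClosure (RatFunc K)) :=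
  IntermediateField.adjoin (RatFunc K) {x | ∃ n : ℕ, aeval x (Phi φ n) = 0}

/-- The integral closure of `K[t]` in `𝓕_φ`. -/
noncomputable def towerIntegers {K : Type*} [Field K] (φ : K[X]) : Subalgebra K[X] (towerField φ) :=
  integralClosure K[X] (towerField φ)

/-- A global specialization at `t₀`: a homomorphism from the integral closure of `K[t]` in `𝓕_φ`
to the algebraic closure of `K` that restricts on `K[t]` to the evaluation `f ↦ f(t₀)`, i.e. a
`K`-algebra homomorphism that sends `t` to `t₀`. -/
structure GlobalSpecialization {K : Type*} [Field K] (φ : K[X]) (t₀ : K) where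
  toRingHom : towerIntegers φ →+* AlgebraicClosure K
  map_poly : ∀ f : K[X], toRingHom (algebraMap K[X] (towerIntegers φ) f) =
    algebraMap K (AlgebraicClosure K) (f.eval t₀)

/-- The image of a global specialization, as a `K`-subalgebra of the algebraic closure of `K`. -/
noncomputable def GlobalSpecialization.range {K : Type*} [Field K] {φ : K[X]} {t₀ : K}
    (σ : GlobalSpecialization φ t₀) : Subalgebra K (AlgebraicClosure K) where
  __ := σ.toRingHom.range.toSubsemiring
  algebraMap_mem' a := ⟨algebraMap K[X] (towerIntegers φ) (C a), by rw [σ.map_poly, eval_C]⟩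

/-- `𝒦_{φ,t₀}`: the image of a global specialization at `t₀`, which is a field between `K` and its
algebraic closure. -/
noncomputable def GlobalSpecialization.field {K : Type*} [Field K] {φ : K[X]} {t₀ : K}
    (σ : GlobalSpecialization φ t₀) : IntermediateField K (AlgebraicClosure K) :=
  σ.range.toIntermediateField fun x hx =>
    σ.range.inv_mem_of_algebraic (x := ⟨x, hx⟩) (Algebra.IsAlgebraic.isAlgebraic (R := K) x)

/-- A homomorphism from `A` to an algebraically closed field extends to integral extensions. -/
theorem exists_extension_of_isIntegral {A B Ω : Type*} [CommRing A] [CommRing B] [Field Ω]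
    [IsAlgClosed Ω] [Algebra A B] [Algebra.IsIntegral A B]
    (hinj : Function.Injective (algebraMap A B)) (f : A →+* Ω) :
    ∃ g : B →+* Ω, ∀ a, g (algebraMap A B a) = f a := by
  have : (RingHom.ker f).IsPrime := RingHom.ker_isPrime f
  obtain ⟨Q, -, hQ, hQP⟩ := Ideal.exists_ideal_over_prime_of_isIntegral (S := B) (RingHom.ker f) ⊥
    (by rw [← RingHom.ker_eq_comap_bot, (RingHom.injective_iff_ker_eq_bot _).1 hinj]; exact bot_le)
  have : Q.LiesOver (RingHom.ker f) := ⟨hQP.symm⟩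
  have hk : Function.Injective (RingHom.kerLift f) := RingHom.kerLift_injective f
  let _ : Algebra (A ⧸ RingHom.ker f) Ω := (RingHom.kerLift f).toAlgebra
  have hf : FaithfulSMul (A ⧸ RingHom.ker f) (B ⧸ Q) := inferInstance
  have : Module.IsTorsionFree (A ⧸ RingHom.ker f) (B ⧸ Q) :=
    Module.isTorsionFree_iff_faithfulSMul.2 hf
  have : Module.IsTorsionFree (A ⧸ RingHom.ker f) Ω :=
    Module.isTorsionFree_iff_algebraMap_injective.2 hk
  have : Algebra.IsIntegral A (B ⧸ Q) := inferInstance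
  have : Algebra.IsIntegral (A ⧸ RingHom.ker f) (B ⧸ Q) := Algebra.IsIntegral.tower_top (R := A)
  let g : (B ⧸ Q) →ₐ[A ⧸ RingHom.ker f] Ω := IsAlgClosed.lift
  refine ⟨g.toRingHom.comp (Ideal.Quotient.mk Q), fun a => ?_⟩
  exact g.commutes (Ideal.Quotient.mk _ a)

/-- Global specializations exist at every `t₀`. -/
theorem nonempty_globalSpecialization {K : Type*} [Field K] (φ : K[X]) (t₀ : K) :
    Nonempty (GlobalSpecialization φ t₀) := by
  have h1 : Function.Injective (algebraMap K[X] (AlgebraicClosure (RatFunc K))) := by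
    rw [IsScalarTower.algebraMap_eq K[X] (RatFunc K)]
    exact (algebraMap (RatFunc K) _).injective.comp (IsFractionRing.injective K[X] (RatFunc K))
  have : Algebra.IsIntegral K[X] (towerIntegers φ) :=
    inferInstanceAs (Algebra.IsIntegral K[X] (integralClosure K[X] (towerField φ)))
  obtain ⟨g, hg⟩ := exists_extension_of_isIntegral (B := towerIntegers φ)
    (fun f g h => h1 (congrArg
      (fun z : towerIntegers φ => ((z : towerField φ) : AlgebraicClosure (RatFunc K))) h))
    ((algebraMap K (AlgebraicClosure K)).comp (evalRingHom t₀))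
  exact ⟨⟨g, hg⟩⟩

end Tower

section Ramification

/-- The valuation `v` of `F` is unramified in the algebraic extension `L/F` (possibly of infinite
degree): every extension of `v` to a valuation of `L` has ramification index one, i.e. the same
value group as `v`, and a residue field that is separable over that of `v`. -/
def UnramifiedIn {F : Type*} [Field F] {Γ : Type*} [LinearOrderedCommGroupWithZero Γ]
    (v : Valuation F Γ) (L : Type*) [Field L] [Algebra F L] : Prop :=
  ∀ (W : ValuationSubring L) [v.HasExtension W.valuation],
    (∀ x : L, ∃ y : F, W.valuation (algebraMap F L y) = W.valuation x) ∧
    Algebra.IsSeparable (IsLocalRing.ResidueField v.valuationSubring)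
      (IsLocalRing.ResidueField W.valuation.valuationSubring)

/-- The places of the rational function field `K(t)` over `K`: the valuation rings of `K(t)` that
contain `K` and are different from `K(t)`. -/
def RatPlace (K : Type*) [Field K] : Type _ :=
  {V : ValuationSubring (RatFunc K) // (∀ a : K, algebraMap K (RatFunc K) a ∈ V) ∧ V ≠ ⊤}

/-- An extension `L` of `K(t)` is finitely ramified: only finitely many places of `K(t)` are
ramified in `L`. -/
def FinitelyRamifiedOverRat (K : Type*) [Field K] (L : Type*) [Field L] [Algebra (RatFunc K) L] :
    Prop :=
  {P : RatPlace K | ¬ UnramifiedIn P.1.valuation L}.Finite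

/-- The places of a number field: the nonzero primes of the ring of integers, and the infinite
places. -/
abbrev NFPlace (K : Type*) [Field K] [NumberField K] : Type _ :=
  HeightOneSpectrum (𝓞 K) ⊕ InfinitePlace K

/-- The set of places of the number field `K` that ramify in the algebraic extension `L/K`. -/
def ramifiedPlaces (K : Type*) [Field K] [NumberField K] (L : Type*) [Field L] [Algebra K L] :
    Set (NFPlace K) :=
  {p | match p with
    | Sum.inl v => ¬ UnramifiedIn (v.valuation K) L
    | Sum.inr w => ¬ w.IsUnramifiedIn L}

/-- The set `S_{φ,t₀}` of the real places of `K` and of the finite places `v` of `K` for which one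
of `d = deg φ`, the leading coefficient of `φ`, and `t₀ - ν` with `ν` in the post-critical set, is
not a unit at `v`; for `t₀ - ν`, an element of the algebraic closure of `K`, this refers to the
extensions of `v` to the algebraic closure. -/
def ramSet {K : Type*} [Field K] [NumberField K] (φ : K[X]) (t₀ : K) : Set (NFPlace K) :=
  {p | match p with
    | Sum.inl v =>
        v.valuation K (φ.natDegree : K) ≠ 1 ∨ v.valuation K φ.leadingCoeff ≠ 1 ∨
        ∃ ν ∈ postCritSet φ, ∃ W : ValuationSubring (AlgebraicClosure K),
          (v.valuation K).HasExtension W.valuation ∧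
          W.valuation (algebraMap K (AlgebraicClosure K) t₀ - ν) ≠ 1
    | Sum.inr w => w.IsReal}

end Ramification

end IteratedTower

/-! Ramification is tested on étale-closed subfields. Let `v` be a discrete valuation of `F` and `W`
an extension of it to `L`. Zorn's lemma gives an intermediate field `E` that is maximal among those
with the value group of `F`. Adjoining a root of a monic `W`-integral polynomial at which the
derivative is a unit does not enlarge a discrete value group (`exists_zpow_of_mem_adjoin_simple`),
so `E` already contains all such roots; it plays the role of an inertia field. Ramification index
one follows once the generators of an extension are found in every such `E`. Separability of residue
fields is automatic, because the residue fields of the base are perfect.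

For (a), if a finite place of `K(t)` does not lie under a post-critical point, the derivative of
each iterate is a unit at the roots of `Φ_n`, so `E` is the whole tower (`isEtaleClosed_eq_top`).
Finitely many places remain when the post-critical set is finite. Conversely, let `r` be critical,
`ν` a later point of its orbit, and `g`, `h` the minimal polynomials of `ν` and `r`. Then `h ^ 2`
divides `g ∘ φ^{∘n}`, so a place where `h(x)` vanishes, with `x` a root of `Φ_n`, ramifies over the
place of `g` (`exists_ramified_place`). A place lies under the conjugates of only one point, so an
infinite orbit ramifies at infinitely many places.

For (b), the tower may itself ramify over `t₀`, so specializing its generators does not suffice.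
Instead the tower is embedded into Hahn series in `T = t - t₀`, solving `φ(x) = a` repeatedly by the
Newton–Puiseux method. If `a = a₀ + b T^q + ...` and `φ - a₀ = (X - r)^e p`, the solutions near `r`
are `r + z T^{q/e} + ...` with `p(r) z^e = b`. When all these `r` and `z` lie in `E`, taking
constant terms is a specialization with values in `E` (`exists_specialization_of_puiseuxClosed`);
normality of the tower transfers this to any specialization (`GlobalSpecialization.field_le`).

The `r` and `z` do lie in `E` when the backward orbit of `t₀` does and `e` and `p(r)` are units
along it. If `t₀` stays away from the post-critical set modulo `v`, so does its backward orbit; then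
`φ'` is a unit there and `e = 1`. If `t₀` is post-critical, its preimages are post-critical or, for
almost all `v`, away from the post-critical set, and only finitely many points impose extra
conditions. -/

namespace IteratedTower

/-! ### Adjoining a root that is simple modulo a discrete valuation -/

section EtaleStep

variable {E L : Type*} [Field E] [Field L] [Algebra E L]

/-- An element that is a root of a monic polynomial with coefficients in a valuation subring lies
in the valuation subring. -/
theorem mem_valuationSubring_of_monic (W : ValuationSubring L) {f : E[X]} (hf : f.Monic)
    (hc : ∀ i, algebraMap E L (f.coeff i) ∈ W) {y : L} (hy : aeval y f = 0) : y ∈ W := by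
  have hl : f.map (algebraMap E L) ∈ Polynomial.lifts (algebraMap W L) := by
    rw [Polynomial.lifts_iff_coeff_lifts]
    intro n
    rw [coeff_map]
    exact ⟨⟨_, hc n⟩, rfl⟩
  obtain ⟨q, hq, -, hqm⟩ := lifts_and_natDegree_eq_and_monic hl (hf.map _)
  have hint : IsIntegral W y := ⟨q, hqm, by rw [← eval_map, hq, eval_map]; exact hy⟩
  obtain ⟨w, hw⟩ := IsIntegrallyClosed.isIntegral_iff.1 hint
  rw [← hw]
  exact w.2

/-- A nonzero element that is algebraic over `E` has value at least that of some nonzero element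
of `E`. -/
theorem exists_valuation_le (W : ValuationSubring L) {z : L} (hz : z ≠ 0) (ha : IsAlgebraic E z) :
    ∃ c : E, c ≠ 0 ∧ W.valuation (algebraMap E L c) ≤ W.valuation z := by
  let R := W.comap (algebraMap E L)
  -- Some multiple `c • z⁻¹` is integral over `R`, hence in `W`; this `c` is the bound.
  have h1 : IsAlgebraic R z⁻¹ := (IsFractionRing.isAlgebraic_iff R E L).2 ha.inv
  obtain ⟨c, hc, hci⟩ := h1.exists_integral_multiple
  refine ⟨c, by simpa using hc, ?_⟩
  obtain ⟨q, hq, hq0⟩ := hci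
  have hmem : c • z⁻¹ ∈ W := by
    refine mem_valuationSubring_of_monic (E := E) W (hq.map R.subtype) (fun i => ?_) (y := c • z⁻¹) ?_
    · rw [coeff_map]
      exact (q.coeff i).2
    · rw [aeval_def, eval₂_map]
      exact hq0
  have h2 : W.valuation (algebraMap E L c * z⁻¹) ≤ 1 := by
    rw [W.valuation_le_one_iff]
    have : c • z⁻¹ = algebraMap E L c * z⁻¹ := by
      rw [Algebra.smul_def]; rfl
    rwa [← this]
  rw [map_mul, map_inv₀] at h2
  rwa [← div_eq_mul_inv, div_le_one₀ (zero_lt_iff.2 (by simpa using hz))] at h2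

/-- Adjoining a root of a polynomial that is separable modulo the valuation does not change a
discrete value group. -/
theorem exists_zpow_of_mem_adjoin_simple (W : ValuationSubring L) {ϖ : E} (hϖ0 : ϖ ≠ 0)
    (hϖ : W.valuation (algebraMap E L ϖ) < 1)
    (hE : ∀ z : E, z ≠ 0 →
      ∃ k : ℤ, W.valuation (algebraMap E L z) = W.valuation (algebraMap E L ϖ) ^ k)
    {y : L} {f : E[X]} (hf : f.Monic) (hc : ∀ i, algebraMap E L (f.coeff i) ∈ W)
    (hy : aeval y f = 0) (hd : W.valuation (aeval y (derivative f)) = 1)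
    {z : L} (hz : z ∈ IntermediateField.adjoin E {y}) (hz0 : z ≠ 0) :
    ∃ k : ℤ, W.valuation z = W.valuation (algebraMap E L ϖ) ^ k := by
  set R := W.comap (algebraMap E L) with hR
  have hyW : y ∈ W := mem_valuationSubring_of_monic W hf hc hy
  let j : R →+* W := ((algebraMap E L).comp R.subtype).codRestrict W.toSubring fun x => x.2
  have hj : ∀ x : R, (j x : L) = algebraMap E L x := fun _ => rfl
  have hvE : ∀ z : L, W.valuation z = 1 → z ≠ 0 := fun z h h0 => by simp [h0] at h
  have : IsLocalHom j := by
    refine ⟨fun a ha => ?_⟩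
    rw [W.valuation_eq_one_iff, hj] at ha
    have ha0 : (a : E) ≠ 0 := fun h => hvE _ ha (by rw [h, map_zero])
    refine isUnit_iff_exists_inv.2 ⟨⟨(a : E)⁻¹, ?_⟩, Subtype.ext (mul_inv_cancel₀ ha0)⟩
    change algebraMap E L (a : E)⁻¹ ∈ W
    rw [← W.valuation_le_one_iff, map_inv₀, map_inv₀, ha, inv_one]
  let ev : R[X] →+* W := eval₂RingHom j ⟨y, hyW⟩
  have hev : ∀ p : R[X], (ev p : L) = aeval y (p.map R.subtype) := fun p => by
    rw [aeval_def, eval₂_map]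
    change W.subtype (eval₂ j ⟨y, hyW⟩ p) = _
    rw [hom_eval₂]
    rfl
  let θ : (IsLocalRing.ResidueField R)[X] →+* IsLocalRing.ResidueField W :=
    eval₂RingHom (IsLocalRing.ResidueField.map j) (IsLocalRing.residue W ⟨y, hyW⟩)
  have hθ : ∀ p : R[X], θ (p.map (IsLocalRing.residue R)) = IsLocalRing.residue W (ev p) := by
    intro p
    change eval₂ _ _ _ = IsLocalRing.residue W (eval₂ j _ p)
    rw [eval₂_map, hom_eval₂]
    rfl
  have hunit : ∀ w : W, IsLocalRing.residue W w ≠ 0 ↔ W.valuation (w : L) = 1 := fun w => by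
    rw [IsLocalRing.residue_ne_zero_iff_isUnit, W.valuation_eq_one_iff]
  have hsurj : ∀ p : (IsLocalRing.ResidueField R)[X],
      ∃ q : R[X], q.map (IsLocalRing.residue R) = p :=
    map_surjective _ IsLocalRing.residue_surjective
  obtain ⟨F, hF⟩ : ∃ F : R[X], F.map R.subtype = f := by
    rw [← mem_lifts, lifts_iff_coeff_lifts]
    exact fun n => ⟨⟨_, hc n⟩, rfl⟩
  -- `g` lifts a generator of the relations satisfied by the residue of `y`, so `p(y)` is a non-unit
  -- only if `g` divides `p` modulo the maximal ideal.
  obtain ⟨g₀, hg₀⟩ : ∃ g, RingHom.ker θ = Ideal.span {g} :=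
    (IsPrincipalIdealRing.principal (RingHom.ker θ)).principal
  obtain ⟨g, rfl⟩ := hsurj g₀
  have hker : ∀ p : R[X], W.valuation (ev p : L) ≠ 1 →
      g.map (IsLocalRing.residue R) ∣ p.map (IsLocalRing.residue R) := fun p hp => by
    rw [← Ideal.mem_span_singleton, ← hg₀, RingHom.mem_ker, hθ]
    by_contra h
    exact hp ((hunit _).1 h)
  have hϖR : ϖ ∈ R := (W.valuation_le_one_iff _).1 hϖ.le
  -- Discreteness enters here: an element of `R` with zero residue is divisible by `ϖ`.
  have hred : ∀ p q : R[X], p.map (IsLocalRing.residue R) = q.map (IsLocalRing.residue R) →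
      ∃ r : R[X], p = q + C ⟨ϖ, hϖR⟩ * r := fun p q hpq => by
    have : C (⟨ϖ, hϖR⟩ : R) ∣ p - q := by
      rw [C_dvd_iff_dvd_coeff]
      intro i
      have h1 : IsLocalRing.residue R ((p - q).coeff i) = 0 := by
        rw [← coeff_map, Polynomial.map_sub, hpq, sub_self, coeff_zero]
      have h2 : ¬ IsUnit (j ((p - q).coeff i)) := fun h => by
        rw [← IsLocalRing.residue_ne_zero_iff_isUnit] at h
        have h3 := (isUnit_of_map_unit j _ (IsLocalRing.residue_ne_zero_iff_isUnit _ |>.1 h))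
        exact (IsLocalRing.residue_ne_zero_iff_isUnit _).2 h3 h1
      set c := (p - q).coeff i with hcdef
      by_cases hc0 : c = 0
      · rw [hc0]; exact dvd_zero _
      have h3 : W.valuation (algebraMap E L c) < 1 :=
        lt_of_le_of_ne ((W.valuation_le_one_iff _).2 c.2)
          fun h => h2 ((W.valuation_eq_one_iff _).2 h)
      obtain ⟨k, hk⟩ := hE c (by simpa using hc0)
      have hϖ' : W.valuation (algebraMap E L ϖ) ≠ 0 := by simpa using hϖ0
      have hk1 : 1 ≤ k := by
        by_contra hlt
        have : 1 ≤ W.valuation (algebraMap E L ϖ) ^ k :=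
          (one_le_zpow_iff_right_of_lt_one₀ (zero_lt_iff.2 hϖ') hϖ).2 (by omega)
        rw [← hk] at this
        exact absurd h3 (not_lt.2 this)
      refine ⟨⟨(c : E) / ϖ, ?_⟩, Subtype.ext (mul_div_cancel₀ (c : E) hϖ0).symm⟩
      change algebraMap E L ((c : E) / ϖ) ∈ W
      rw [← W.valuation_le_one_iff, map_div₀, map_div₀, hk, div_eq_mul_inv, ← zpow_sub_one₀ hϖ']
      obtain ⟨m, hm⟩ := Int.eq_ofNat_of_zero_le (sub_nonneg.2 hk1)
      rw [hm, zpow_natCast]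
      exact pow_le_one₀ zero_le hϖ.le
    obtain ⟨r, hr⟩ := this
    exact ⟨r, by rw [← hr]; ring⟩
  obtain ⟨h, hh⟩ : ∃ h : R[X], F.map (IsLocalRing.residue R) = g.map (IsLocalRing.residue R) *
      h.map (IsLocalRing.residue R) := by
    have : W.valuation (ev F : L) ≠ 1 := by rw [hev, hF, hy]; simp
    obtain ⟨h₀, hh₀⟩ := hker F this
    obtain ⟨h, rfl⟩ := hsurj h₀
    exact ⟨h, hh₀⟩
  -- Since `g(y)` reduces to zero, `f'(y)` reduces to `g'(y) h(y)`; it is a unit, so `h(y)` is one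
  -- too.
  have hhy : W.valuation (ev h : L) = 1 := by
    rw [← hunit, ← hθ]
    intro h0
    have hg : θ (g.map (IsLocalRing.residue R)) = 0 := by
      rw [← RingHom.mem_ker, hg₀]; exact Ideal.mem_span_singleton_self _
    have h1 : θ (derivative (F.map (IsLocalRing.residue R))) = 0 := by
      rw [hh, derivative_mul, map_add, map_mul, map_mul, h0, hg, mul_zero, zero_mul, add_zero]
    rw [derivative_map, hθ] at h1
    refine (hunit _).2 ?_ h1
    rw [hev, ← derivative_map, hF, hd]
  obtain ⟨r, hr⟩ := hred F (g * h) (by rw [hh, Polynomial.map_mul])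
  -- From `F = g h + ϖ r` and `p = g q + ϖ r'` follows `h p = F q + ϖ (h r' - r q)`. At `y` the term
  -- with `F` vanishes and `h(y)` is a unit, so one factor `ϖ` splits off.
  have hstep : ∀ p : R[X], W.valuation (ev p : L) ≠ 1 →
      ∃ q : R[X], W.valuation (ev p : L) =
        W.valuation (algebraMap E L ϖ) * W.valuation (ev q : L) := by
    intro p hp
    obtain ⟨q₀, hq₀⟩ := hker p hp
    obtain ⟨q, rfl⟩ := hsurj q₀
    obtain ⟨r', hr'⟩ := hred p (g * q) (by rw [hq₀, Polynomial.map_mul])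
    refine ⟨h * r' - r * q, ?_⟩
    have h1 : (h * p : R[X]) = F * q + C ⟨ϖ, hϖR⟩ * (h * r' - r * q) := by
      rw [hr', hr]; ring
    have h2 := congrArg (fun s => W.valuation (ev s : L)) h1
    have hFy : ev F = 0 := Subtype.ext (by rw [hev, hF, hy]; rfl)
    have hCy : (ev (C ⟨ϖ, hϖR⟩) : L) = algebraMap E L ϖ := by
      rw [hev, map_C, aeval_C]; rfl
    simp only [map_mul, map_add, hFy, zero_mul, zero_add] at h2
    change W.valuation ((ev h : L) * (ev p : L)) =
      W.valuation ((ev (C ⟨ϖ, hϖR⟩) : L) * (ev (h * r' - r * q) : L)) at h2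
    rwa [map_mul, map_mul, hhy, one_mul, hCy] at h2
  -- The lower bound `ϖ ^ N` makes the splitting off of factors `ϖ` stop; `exists_valuation_le`
  -- supplies it.
  have hind : ∀ (N : ℕ) (p : R[X]), W.valuation (algebraMap E L ϖ) ^ N ≤ W.valuation (ev p : L) →
      ∃ k : ℤ, W.valuation (ev p : L) = W.valuation (algebraMap E L ϖ) ^ k := by
    intro N
    induction N with
    | zero =>
      intro p hp
      exact ⟨0, by rw [zpow_zero]; exact le_antisymm (W.valuation_le_one _) (by simpa using hp)⟩
    | succ N ih =>
      intro p hp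
      by_cases h1 : W.valuation (ev p : L) = 1
      · exact ⟨0, by rw [zpow_zero, h1]⟩
      obtain ⟨q, hq⟩ := hstep p h1
      have hϖ' : W.valuation (algebraMap E L ϖ) ≠ 0 := by simpa using hϖ0
      obtain ⟨k, hk⟩ := ih q (by
        rw [hq, pow_succ'] at hp
        exact (mul_le_mul_iff_right₀ (zero_lt_iff.2 hϖ')).1 hp)
      exact ⟨k + 1, by rw [hq, hk, zpow_add_one₀ hϖ', mul_comm]⟩
  have hyint : ∀ p : E[X], IsAlgebraic E (aeval y p) := fun p =>
    IsIntegral.isAlgebraic (adjoin_le_integralClosure (R := E) (x := y) ⟨f, hf, hy⟩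
      (aeval_mem_adjoin_singleton E y))
  have hpol : ∀ p : E[X], aeval y p ≠ 0 →
      ∃ k : ℤ, W.valuation (aeval y p) = W.valuation (algebraMap E L ϖ) ^ k := by
    intro p hp
    obtain ⟨b, hb, hbp⟩ := IsLocalization.integerNormalization_spec (nonZeroDivisors R) p
    set q := IsLocalization.integerNormalization (nonZeroDivisors R) p
    have hϖ' : W.valuation (algebraMap E L ϖ) ≠ 0 := by simpa using hϖ0
    have hb0 : (b : E) ≠ 0 := by simpa using nonZeroDivisors.ne_zero hb
    have hq : (ev q : L) = algebraMap E L b * aeval y p := by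
      rw [hev]
      change aeval y (q.map (algebraMap R E)) = _
      have : b • p = C (b : E) * p := by
        ext i
        rw [coeff_smul, coeff_C_mul]
        rfl
      rw [hbp, this, map_mul, aeval_C]
    have hq0 : (ev q : L) ≠ 0 := by
      rw [hq]
      exact mul_ne_zero (by simpa using hb0) hp
    obtain ⟨c, hc0, hcle⟩ := exists_valuation_le (E := E) W hq0
      (by rw [hev]; exact hyint _)
    obtain ⟨k, hk⟩ := hE c hc0
    obtain ⟨l, hl⟩ := hind k.toNat q (le_trans (by
      rw [hk, ← zpow_natCast]
      exact (zpow_le_zpow_iff_right_of_lt_one₀ (zero_lt_iff.2 hϖ') hϖ).2 (Int.self_le_toNat k)) hcle)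
    obtain ⟨m, hm⟩ := hE b hb0
    refine ⟨l - m, ?_⟩
    rw [hq, map_mul, hm] at hl
    rw [zpow_sub₀ hϖ', ← hl, mul_div_cancel_left₀ _ (zpow_ne_zero _ hϖ')]
  rw [IntermediateField.mem_adjoin_simple_iff] at hz
  obtain ⟨p, q, rfl⟩ := hz
  obtain ⟨k, hk⟩ := hpol p (fun h => hz0 (by rw [h, zero_div]))
  obtain ⟨l, hl⟩ := hpol q (fun h => hz0 (by rw [h, div_zero]))
  have hϖ' : W.valuation (algebraMap E L ϖ) ≠ 0 := by simpa using hϖ0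
  exact ⟨k - l, by rw [map_div₀, hk, hl, zpow_sub₀ hϖ']⟩

end EtaleStep

/-! ### Maximal subfields with the same value group -/

section EtaleClosed

variable {F L : Type*} [Field F] [Field L] [Algebra F L]

/-- The intermediate field `E` contains the roots in `L` of every monic polynomial over `E` with
coefficients in `W`, at which the derivative is a unit of `W`. -/
def IsEtaleClosed (W : ValuationSubring L) (E : IntermediateField F L) : Prop :=
  ∀ f : E[X], f.Monic → (∀ i, algebraMap E L (f.coeff i) ∈ W) → ∀ y : L, aeval y f = 0 →
    W.valuation (aeval y (derivative f)) = 1 → y ∈ E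

/-- A discretely valued field has an extension inside `L` with the same value group that is closed
under the roots of polynomials that are separable modulo the valuation. -/
theorem exists_isEtaleClosed (W : ValuationSubring L) {ϖ : F} (hϖ0 : ϖ ≠ 0)
    (hϖ : W.valuation (algebraMap F L ϖ) < 1)
    (hF : ∀ z : F, z ≠ 0 →
      ∃ k : ℤ, W.valuation (algebraMap F L z) = W.valuation (algebraMap F L ϖ) ^ k) :
    ∃ E : IntermediateField F L, IsEtaleClosed W E ∧
      ∀ z ∈ E, ∃ x : F, W.valuation (algebraMap F L x) = W.valuation z := by
  let S : Set (IntermediateField F L) :=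
    {E | ∀ z ∈ E, z ≠ 0 → ∃ k : ℤ, W.valuation z = W.valuation (algebraMap F L ϖ) ^ k}
  have hbot : (⊥ : IntermediateField F L) ∈ S := by
    intro z hz hz0
    obtain ⟨x, rfl⟩ := IntermediateField.mem_bot.1 hz
    exact hF x (by simpa using hz0)
  -- Membership in `S` is tested on single elements, so it passes to unions of chains.
  obtain ⟨E, -, hE⟩ := zorn_le_nonempty₀ S (by
    intro c hcS hc E₀ hE₀
    have : Nonempty c := ⟨⟨E₀, hE₀⟩⟩
    refine ⟨⨆ i : c, i.1, fun z hz hz0 => ?_, fun E hE => le_iSup (fun i : c => i.1) ⟨E, hE⟩⟩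
    have hdir : Directed (· ≤ ·) fun i : c => i.1 := hc.directed
    rw [← SetLike.mem_coe, IntermediateField.coe_iSup_of_directed hdir, Set.mem_iUnion] at hz
    obtain ⟨i, hi⟩ := hz
    exact hcS i.2 z hi hz0) ⊥ hbot
  refine ⟨E, fun f hf hc y hy hd => ?_, fun z hz => ?_⟩
  · have hle : E ≤ (IntermediateField.adjoin E {y}).restrictScalars F :=
      fun x hx => IntermediateField.algebraMap_mem _ (⟨x, hx⟩ : E)
    refine hE.le_of_ge (y := (IntermediateField.adjoin E {y}).restrictScalars F) ?_ hle
      (IntermediateField.mem_adjoin_simple_self E y)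
    intro z hz hz0
    exact exists_zpow_of_mem_adjoin_simple W (ϖ := algebraMap F E ϖ) (by simpa using hϖ0) hϖ
      (fun z hz0 => hE.prop z z.2 (by simpa using hz0)) hf hc hy hd hz hz0
  · by_cases hz0 : z = 0
    · exact ⟨0, by simp [hz0]⟩
    obtain ⟨k, hk⟩ := hE.prop z hz hz0
    exact ⟨ϖ ^ k, by rw [hk, map_zpow₀, map_zpow₀]⟩

end EtaleClosed

/-! ### Residue field extensions -/

section Residue

variable {F L Γ : Type*} [Field F] [Field L] [Algebra F L] [LinearOrderedCommGroupWithZero Γ]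

/-- A nonzero polynomial over a valued field can be scaled to be primitive. -/
theorem exists_primitive_scaling (v : Valuation F Γ) {p : F[X]} (hp : p ≠ 0) :
    ∃ (q : v.valuationSubring[X]) (c : F), c ≠ 0 ∧
      q.map (algebraMap v.valuationSubring F) = C c * p ∧ ∃ i, q.coeff i = 1 := by
  obtain ⟨i, hi, hmax⟩ := p.support.exists_max_image (fun i => v (p.coeff i))
    (support_nonempty.2 hp)
  have hi0 : p.coeff i ≠ 0 := mem_support_iff.1 hi
  have hmem : C (p.coeff i)⁻¹ * p ∈ lifts (algebraMap v.valuationSubring F) := by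
    rw [lifts_iff_coeff_lifts]
    intro n
    refine ⟨⟨(C (p.coeff i)⁻¹ * p).coeff n, ?_⟩, rfl⟩
    rw [v.mem_valuationSubring_iff, coeff_C_mul, map_mul, map_inv₀, mul_comm, ← div_eq_mul_inv,
      div_le_one₀ (zero_lt_iff.2 (by simpa using hi0))]
    by_cases hn : n ∈ p.support
    · exact hmax n hn
    · rw [notMem_support_iff.1 hn, map_zero]
      exact zero_le
  obtain ⟨q, hq⟩ := (mem_lifts _).1 hmem
  refine ⟨q, (p.coeff i)⁻¹, inv_ne_zero hi0, hq, i, ?_⟩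
  apply IsFractionRing.injective v.valuationSubring F
  rw [← coeff_map, hq, coeff_C_mul, inv_mul_cancel₀ hi0, map_one]

/-- The residue field extension of an algebraic extension of valued fields is algebraic. -/
theorem isAlgebraic_residueField [Algebra.IsAlgebraic F L] (v : Valuation F Γ)
    (W : ValuationSubring L) [v.HasExtension W.valuation] :
    Algebra.IsAlgebraic (IsLocalRing.ResidueField v.valuationSubring)
      (IsLocalRing.ResidueField W.valuation.valuationSubring) := by
  refine ⟨fun x => ?_⟩
  obtain ⟨w, rfl⟩ := IsLocalRing.residue_surjective x
  obtain ⟨p, hp, hpw⟩ := Algebra.IsAlgebraic.isAlgebraic (R := F) (w : L)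
  obtain ⟨q, c, hc, hq, i, hi⟩ := exists_primitive_scaling v hp
  -- The coefficient `1` keeps the reduction of the scaled relation nonzero.
  refine ⟨q.map (IsLocalRing.residue _), fun h => ?_, ?_⟩
  · have := congrArg (coeff · i) h
    simp only [coeff_map, hi, map_one, coeff_zero, one_ne_zero] at this
  · have h1 : aeval w q = 0 := by
      apply Subtype.val_injective
      have : ((aeval w q : W.valuation.valuationSubring) : L) = aeval (w : L) q := by
        rw [← ValuationSubring.algebraMap_apply, ← aeval_algebraMap_apply]
        rfl
      rw [this, ← aeval_map_algebraMap (A := F), hq, map_mul, hpw, mul_zero]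
      rfl
    rw [aeval_def, eval₂_map]
    have h2 := congrArg (IsLocalRing.residue _) h1
    rw [aeval_def, hom_eval₂, map_zero] at h2
    exact h2

/-- Over a perfect residue field, ramification only concerns value groups. -/
theorem unramifiedIn_of_values [Algebra.IsAlgebraic F L] (v : Valuation F Γ)
    [PerfectField (IsLocalRing.ResidueField v.valuationSubring)]
    (h : ∀ (W : ValuationSubring L) [v.HasExtension W.valuation],
      ∀ x : L, ∃ y : F, W.valuation (algebraMap F L y) = W.valuation x) : UnramifiedIn v L := by
  intro W _
  have := isAlgebraic_residueField v W
  exact ⟨h W, inferInstance⟩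

end Residue

/-! ### Valuations of primes of Dedekind domains and their residue fields -/

section HeightOne

variable {A F L : Type*} [CommRing A] [IsDedekindDomain A] [Field F] [Algebra A F]
  [IsFractionRing A F] [Field L] [Algebra F L]

/-- A uniformizer of `v` serves as `ϖ`, since every nonzero value is a power of its value. -/
theorem exists_isEtaleClosed_of_heightOne (v : HeightOneSpectrum A) (W : ValuationSubring L)
    [(v.valuation F).HasExtension W.valuation] :
    ∃ E : IntermediateField F L, IsEtaleClosed W E ∧
      ∀ z ∈ E, ∃ x : F, W.valuation (algebraMap F L x) = W.valuation z := by
  obtain ⟨ϖ, hϖ⟩ := v.valuation_exists_uniformizer F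
  have h0 : ϖ ≠ 0 := by
    rintro rfl
    rw [map_zero] at hϖ
    exact WithZero.exp_ne_zero hϖ.symm
  refine exists_isEtaleClosed W h0 ?_ fun z hz => ?_
  · rw [Valuation.HasExtension.val_map_lt_one_iff (v.valuation F), hϖ, ← WithZero.exp_zero,
      WithZero.exp_lt_exp]
    norm_num
  · have hz' : v.valuation F z ≠ 0 := by simpa using hz
    -- The sign is due to the uniformizer having value `exp (-1)`.
    refine ⟨-(WithZero.log (v.valuation F z)), ?_⟩
    rw [← map_zpow₀, ← map_zpow₀, Valuation.HasExtension.val_map_eq_iff (v.valuation F), map_zpow₀,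
      hϖ, ← WithZero.exp_zsmul, smul_neg, neg_smul, neg_neg, smul_eq_mul, mul_one,
      WithZero.exp_log hz']

/-- The map from `A` to the residue field of the valuation of one of its primes. -/
noncomputable def toResidueField (F : Type*) [Field F] [Algebra A F] [IsFractionRing A F]
    (v : HeightOneSpectrum A) :
    A →+* IsLocalRing.ResidueField (v.valuation F).valuationSubring :=
  (IsLocalRing.residue _).comp ((algebraMap A F).codRestrict
    (v.valuation F).valuationSubring.toSubring fun a => v.valuation_le_one a)

theorem toResidueField_surjective (v : HeightOneSpectrum A) :
    Function.Surjective (toResidueField F v) := fun x => by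
  obtain ⟨y, rfl⟩ := IsLocalRing.residue_surjective x
  obtain ⟨a, ha⟩ := v.exists_valuation_sub_lt_of_integer (K := F) y.2 1
  refine ⟨a, ?_⟩
  change IsLocalRing.residue _ _ = _
  rw [← sub_eq_zero, ← map_sub, IsLocalRing.residue_eq_zero_iff, Valuation.mem_maximalIdeal_iff]
  exact ha

theorem toResidueField_eq_zero (v : HeightOneSpectrum A) {a : A} (ha : a ∈ v.asIdeal) :
    toResidueField F v a = 0 := by
  change IsLocalRing.residue _ _ = 0
  rw [IsLocalRing.residue_eq_zero_iff, Valuation.mem_maximalIdeal_iff]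
  exact (v.valuation_lt_one_iff_mem a).2 ha

theorem perfectField_residueField_of_finite (v : HeightOneSpectrum A) [Finite (A ⧸ v.asIdeal)] :
    PerfectField (IsLocalRing.ResidueField (v.valuation F).valuationSubring) := by
  have : Finite (IsLocalRing.ResidueField (v.valuation F).valuationSubring) :=
    Finite.of_surjective (Ideal.Quotient.lift v.asIdeal (toResidueField F v) fun a ha =>
      toResidueField_eq_zero v ha)
      (Ideal.Quotient.lift_surjective_of_surjective _ _ (toResidueField_surjective v))
  infer_instance

/-- The residue field is generated over `K` by the class of `X`, which is a root of any nonzero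
element of the prime; algebraic extensions of perfect fields are perfect. -/
theorem perfectField_residueField_of_polynomial {K : Type*} [Field K] [PerfectField K]
    [Algebra K[X] F] [IsFractionRing K[X] F] (v : HeightOneSpectrum K[X]) :
    PerfectField (IsLocalRing.ResidueField (v.valuation F).valuationSubring) := by
  let _ : Algebra K (IsLocalRing.ResidueField (v.valuation F).valuationSubring) :=
    ((toResidueField F v).comp C).toAlgebra
  have hp : ∀ p : K[X], toResidueField F v p = aeval (toResidueField F v X) p := fun p => by
    conv_lhs => rw [← eval₂_C_X (p := p)]
    rw [hom_eval₂]
    rfl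
  obtain ⟨g, hg, hg0⟩ := v.asIdeal.ne_bot_iff.1 v.ne_bot
  have hX : IsIntegral K (toResidueField F v X) := by
    rw [← isAlgebraic_iff_isIntegral]
    exact ⟨g, hg0, by rw [← hp, toResidueField_eq_zero v hg]⟩
  have : Algebra.IsAlgebraic K (IsLocalRing.ResidueField (v.valuation F).valuationSubring) := by
    refine ⟨fun x => ?_⟩
    obtain ⟨p, rfl⟩ := toResidueField_surjective v x
    rw [hp]
    exact IsIntegral.isAlgebraic (adjoin_le_integralClosure hX (aeval_mem_adjoin_singleton K _))
  exact Algebra.IsAlgebraic.perfectField K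

end HeightOne

/-! ### Iterates, critical orbits and the post-critical set -/

section Iterates

variable {K : Type*} [Field K] (φ : K[X])

theorem iter_zero : iter φ 0 = X := rfl

theorem iter_succ (n : ℕ) : iter φ (n + 1) = φ.comp (iter φ n) := by
  rw [iter, Function.iterate_succ_apply']
  rfl

theorem aeval_iter_succ {A : Type*} [CommRing A] [Algebra K A] (n : ℕ) (x : A) :
    aeval x (iter φ (n + 1)) = aeval (aeval x (iter φ n)) φ := by
  rw [iter_succ, aeval_comp]

/-- With `φ` innermost, a backward orbit can be followed one preimage at a time. -/
theorem aeval_iter_succ' {A : Type*} [CommRing A] [Algebra K A] (n : ℕ) (x : A) :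
    aeval x (iter φ (n + 1)) = aeval (aeval x φ) (iter φ n) := by
  induction n with
  | zero => simp [iter_succ, iter_zero]
  | succ n ih => rw [aeval_iter_succ, ih, aeval_iter_succ]

theorem aeval_iter (n : ℕ) (x : AlgebraicClosure K) : aeval x (iter φ n) = (polyMap φ)^[n] x := by
  induction n with
  | zero => simp [iter_zero]
  | succ n ih => rw [aeval_iter_succ, ih, Function.iterate_succ_apply']; rfl

theorem derivative_iter_succ (n : ℕ) : derivative (iter φ (n + 1)) =
    derivative (iter φ n) * (derivative φ).comp (iter φ n) := by
  rw [iter_succ, derivative_comp]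

variable {φ}

theorem polyMap_mem_postCritSet {ν : AlgebraicClosure K} (hν : ν ∈ postCritSet φ) :
    aeval ν φ ∈ postCritSet φ := by
  obtain ⟨r, hr, n, rfl⟩ := hν
  exact ⟨r, hr, n + 1, by rw [Function.iterate_succ_apply']; rfl⟩

theorem critPoints_subset_postCritSet : critPoints φ ⊆ postCritSet φ :=
  fun r hr => ⟨r, hr, 0, rfl⟩

/-- The critical values of the iterates of `φ` are post-critical. -/
theorem aeval_iter_mem_postCritSet {n : ℕ} {s : AlgebraicClosure K}
    (h : aeval s (derivative (iter φ n)) = 0) : aeval s (iter φ n) ∈ postCritSet φ := by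
  induction n with
  | zero => simp [iter_zero] at h
  | succ n ih =>
    rw [derivative_iter_succ, map_mul, mul_eq_zero, aeval_comp] at h
    rw [aeval_iter_succ]
    rcases h with h | h
    · exact polyMap_mem_postCritSet (ih h)
    · exact polyMap_mem_postCritSet (critPoints_subset_postCritSet h)

/-- By the chain rule `φ'(r)` is a factor from the first iterate on; the zeroth iterate `X` has no
critical point. -/
theorem aeval_derivative_iter_succ_eq_zero {r : AlgebraicClosure K} (hr : r ∈ critPoints φ)
    (n : ℕ) : aeval r (derivative (iter φ (n + 1))) = 0 := by
  induction n with
  | zero => simpa [derivative_iter_succ, iter_zero] using (show aeval r (derivative φ) = 0 from hr)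
  | succ n ih => rw [derivative_iter_succ, map_mul, ih, zero_mul]

/-- A repetition at times `m < n` would make the `m`-th point periodic with period `n - m`. -/
theorem iterate_injective_of_not_isPreperiodic {r : AlgebraicClosure K}
    (hr : ¬ IsPreperiodic φ r) : Function.Injective fun n => (polyMap φ)^[n] r := by
  have key : ∀ m n, m < n → (polyMap φ)^[m] r ≠ (polyMap φ)^[n] r := fun m n hmn h => by
    refine hr ⟨m, n - m, by omega, ?_⟩
    rw [Function.IsPeriodicPt, Function.IsFixedPt, ← Function.iterate_add_apply,
      Nat.sub_add_cancel hmn.le, h]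
  intro m n h
  rcases lt_trichotomy m n with hmn | hmn | hmn
  · exact absurd h (key m n hmn)
  · exact hmn
  · exact absurd h.symm (key n m hmn)

theorem critPoints_finite (hφ : derivative φ ≠ 0) : (critPoints φ).Finite := by
  classical
  refine (((derivative φ).aroots (AlgebraicClosure K)).toFinset.finite_toSet).subset fun r hr => ?_
  rw [Finset.mem_coe, Multiset.mem_toFinset, mem_aroots]
  exact ⟨hφ, hr⟩

theorem orbit_finite {r : AlgebraicClosure K} (hr : IsPreperiodic φ r) :
    (Set.range fun n => (polyMap φ)^[n] r).Finite := by
  classical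
  obtain ⟨m, k, hk, hper⟩ := hr
  -- After a tail of length `m` the orbit repeats with period `k`, so the first `m + k` points
  -- exhaust it.
  refine ((Finset.range (m + k)).image fun n => (polyMap φ)^[n] r).finite_toSet.subset ?_
  rintro _ ⟨n, rfl⟩
  rw [Finset.mem_coe, Finset.mem_image]
  by_cases hn : n < m
  · exact ⟨n, Finset.mem_range.2 (by omega), rfl⟩
  · refine ⟨m + (n - m) % k, Finset.mem_range.2 (by have := Nat.mod_lt (n - m) hk; omega), ?_⟩
    have h1 := hper.iterate_mod_apply (n - m)
    rw [← Function.iterate_add_apply, ← Function.iterate_add_apply, Nat.sub_add_cancel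
      (not_lt.1 hn)] at h1
    rw [add_comm m]
    exact h1

theorem postCritSet_finite (hφ : derivative φ ≠ 0) (h : IsPCF φ) : (postCritSet φ).Finite := by
  refine ((critPoints_finite hφ).biUnion fun r hr => orbit_finite (h r hr)).subset ?_
  rintro ν ⟨r, hr, n, rfl⟩
  exact Set.mem_biUnion hr ⟨n, rfl⟩

theorem natDegree_iter (n : ℕ) : (iter φ n).natDegree = φ.natDegree ^ n := by
  induction n with
  | zero => simp [iter_zero]
  | succ n ih => rw [iter_succ, natDegree_comp, ih, pow_succ']

theorem natDegree_pos_of_derivative_ne_zero (hφ : derivative φ ≠ 0) : 0 < φ.natDegree := by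
  rw [Nat.pos_iff_ne_zero]
  intro h
  exact hφ (by rw [eq_C_of_natDegree_eq_zero h, derivative_C])

theorem natDegree_iter_pos (hφ : 0 < φ.natDegree) (n : ℕ) : 0 < (iter φ n).natDegree := by
  rw [natDegree_iter]
  exact pow_pos hφ n

end Iterates

/-! ### Étale-closedness for unit leading coefficients -/

section EtaleRoots

variable {F L : Type*} [Field F] [Field L] [Algebra F L]

/-- Roots at which the derivative is a unit, for a polynomial with unit leading coefficient. -/
theorem IsEtaleClosed.mem {W : ValuationSubring L} {E : IntermediateField F L}
    (hE : IsEtaleClosed W E) {g : E[X]} (hc : ∀ i, algebraMap E L (g.coeff i) ∈ W)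
    (hl : W.valuation (algebraMap E L g.leadingCoeff) = 1) {y : L} (hy : aeval y g = 0)
    (hd : W.valuation (aeval y (derivative g)) = 1) : y ∈ E := by
  have hg : g ≠ 0 := fun h => by simp [h] at hl
  have hl0 : g.leadingCoeff ≠ 0 := leadingCoeff_ne_zero.2 hg
  have hlW : W.valuation (algebraMap E L g.leadingCoeff⁻¹) = 1 := by
    rw [map_inv₀, map_inv₀, hl, inv_one]
  refine hE (C g.leadingCoeff⁻¹ * g) (monic_C_mul_of_mul_leadingCoeff_eq_one
    (inv_mul_cancel₀ hl0)) (fun i => ?_) y ?_ ?_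
  · rw [coeff_C_mul, map_mul]
    exact W.mul_mem _ _ ((W.valuation_le_one_iff _).1 hlW.le) (hc i)
  · rw [map_mul, hy, mul_zero]
  · rw [derivative_C_mul, map_mul, map_mul, hd, mul_one, aeval_C, hlW]

end EtaleRoots

/-! ### Places of the rational function field -/

section Places

/-- A valuation subring pulls back along field extensions. -/
theorem hasExtension_of_comap_eq {F L Γ : Type*} [Field F] [Field L] [Algebra F L]
    [LinearOrderedCommGroupWithZero Γ] {v : Valuation F Γ} {W : ValuationSubring L}
    (h : W.comap (algebraMap F L) = v.valuationSubring) : v.HasExtension W.valuation where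
  val_isEquiv_comap := by
    rw [Valuation.isEquiv_iff_val_le_one]
    intro x
    rw [← v.mem_valuationSubring_iff, ← h, ValuationSubring.mem_comap, Valuation.comap_apply,
      W.valuation_le_one_iff]

theorem comap_eq_of_hasExtension {F L Γ : Type*} [Field F] [Field L] [Algebra F L]
    [LinearOrderedCommGroupWithZero Γ] (v : Valuation F Γ) (W : ValuationSubring L)
    [v.HasExtension W.valuation] : W.comap (algebraMap F L) = v.valuationSubring := by
  ext x
  rw [ValuationSubring.mem_comap, v.mem_valuationSubring_iff, ← W.valuation_le_one_iff,
    Valuation.HasExtension.val_map_le_one_iff v]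

variable {K : Type*} [Field K]

theorem polynomial_mem_of_X_mem {P : ValuationSubring (RatFunc K)}
    (hK : ∀ a : K, algebraMap K (RatFunc K) a ∈ P) (hX : RatFunc.X ∈ P) (p : K[X]) :
    algebraMap K[X] (RatFunc K) p ∈ P := by
  induction p using Polynomial.induction_on' with
  | add p q hp hq => rw [map_add]; exact P.add_mem _ _ hp hq
  | monomial n a =>
    rw [← C_mul_X_pow_eq_monomial, map_mul, map_pow, RatFunc.algebraMap_X, RatFunc.algebraMap_C]
    exact P.mul_mem _ _ (hK a) (pow_mem hX n)

/-- A place of `K(t)` at which `t` is finite is given by a nonzero prime of `K[t]`. -/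
theorem RatPlace.exists_heightOneSpectrum (P : RatPlace K) (hX : RatFunc.X ∈ P.1) :
    ∃ v : HeightOneSpectrum K[X], (v.valuation (RatFunc K)).valuationSubring = P.1 ∧
      ∀ p : K[X], p ∈ v.asIdeal ↔ algebraMap K[X] (RatFunc K) p ∈ P.1.nonunits := by
  obtain ⟨P, hK, htop⟩ := P
  change RatFunc.X ∈ P at hX
  have hpol := polynomial_mem_of_X_mem hK hX
  let f : K[X] →+* P := (algebraMap K[X] (RatFunc K)).codRestrict P.toSubring hpol
  have hf : ∀ p, p ∈ (IsLocalRing.maximalIdeal P).comap f ↔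
      algebraMap K[X] (RatFunc K) p ∈ P.nonunits := fun p => by
    rw [Ideal.mem_comap, P.valuation_lt_one_iff, P.mem_nonunits_iff]
    rfl
  -- If the centre of `P` on `K[t]` were zero, all nonzero polynomials would be invertible in `P`,
  -- and `P` would be all of `K(t)`.
  have hbot : (IsLocalRing.maximalIdeal P).comap f ≠ ⊥ := by
    intro hbot
    refine htop (eq_top_iff.2 fun x _ => ?_)
    induction x using RatFunc.induction_on with
    | f p q hq =>
      rw [div_eq_mul_inv]
      refine P.mul_mem _ _ (hpol p) ?_
      have : q ∉ (IsLocalRing.maximalIdeal P).comap f := by rw [hbot]; simpa using hq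
      rw [hf, P.mem_nonunits_iff_or, not_or, not_not] at this
      exact this.2
  let v : HeightOneSpectrum K[X] := ⟨_, Ideal.comap_isPrime f (IsLocalRing.maximalIdeal P), hbot⟩
  refine ⟨v, ?_, hf⟩
  -- The valuation ring of a height-one prime is a maximal proper subring, so one inclusion is
  -- enough.
  refine ValuationSubring.eq_of_le_of_ne_top _ (fun x hx => ?_) htop
  obtain ⟨n, d, hd⟩ := v.exists_primeCompl_mul_eq_of_integer x hx
  have hd' : (d : K[X]) ∉ v.asIdeal := d.2
  rw [hf, P.mem_nonunits_iff_or, not_or, not_not] at hd'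
  rw [← mul_inv_cancel_right₀ hd'.1 x, hd]
  exact P.mul_mem _ _ (hpol n) hd'.2

/-- There is at most one place of `K(t)` at which `t` is infinite. -/
theorem RatPlace.eq_of_X_notMem {P Q : RatPlace K} (hP : RatFunc.X ∉ P.1)
    (hQ : RatFunc.X ∉ Q.1) : P = Q := by
  classical
  have key : ∀ P : RatPlace K, RatFunc.X ∉ P.1 →
      P.1 = (RatFunc.inftyValuation K).valuationSubring := by
    rintro ⟨P, hK, htop⟩ hP
    have : P.valuation.IsTrivialOn K := ⟨fun a ha => by
      have h1 := (P.valuation_le_one_iff _).2 (hK a)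
      have h2 := (P.valuation_le_one_iff _).2 (hK a⁻¹)
      refine le_antisymm h1 ?_
      rw [map_inv₀, map_inv₀] at h2
      exact (inv_le_one₀ (zero_lt_iff.2 (by simpa using ha))).1 h2⟩
    have h := RatFunc.valuation_isEquiv_inftyValuation_of_one_lt_valuation_X
      (v := P.valuation) (by
        rw [← not_le, P.valuation_le_one_iff]
        exact hP)
    rw [Valuation.isEquiv_iff_valuationSubring, P.valuationSubring_valuation] at h
    exact h
  exact Subtype.ext ((key P hP).trans (key Q hQ).symm)

/-- Two places of `K(t)` at which the same irreducible polynomial vanishes are equal. -/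
theorem RatPlace.eq_of_irreducible {P Q : RatPlace K} (hP : RatFunc.X ∈ P.1)
    (hQ : RatFunc.X ∈ Q.1) {g : K[X]} (hg : Irreducible g)
    (hgP : algebraMap K[X] (RatFunc K) g ∈ P.1.nonunits)
    (hgQ : algebraMap K[X] (RatFunc K) g ∈ Q.1.nonunits) : P = Q := by
  obtain ⟨v, hv, hv'⟩ := P.exists_heightOneSpectrum hP
  obtain ⟨w, hw, hw'⟩ := Q.exists_heightOneSpectrum hQ
  have hmax := PrincipalIdealRing.isMaximal_of_irreducible hg
  have h1 : Ideal.span {g} = v.asIdeal := hmax.eq_of_le v.isPrime.ne_top (by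
    rw [Ideal.span_singleton_le_iff_mem, hv']; exact hgP)
  have h2 : Ideal.span {g} = w.asIdeal := hmax.eq_of_le w.isPrime.ne_top (by
    rw [Ideal.span_singleton_le_iff_mem, hw']; exact hgQ)
  have h3 : v = w := HeightOneSpectrum.ext (h1.symm.trans h2)
  exact Subtype.ext (by rw [← hv, ← hw, h3])

end Places

/-! ### Post-critically finite implies finitely ramified -/

section TowerRoots

variable {K : Type*} [Field K] {φ : K[X]}

theorem aeval_Phi {L : Type*} [Field L] [Algebra (RatFunc K) L] [Algebra K L]
    [IsScalarTower K (RatFunc K) L] (n : ℕ) (x : L) :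
    aeval x (Phi φ n) = aeval x (iter φ n) - algebraMap (RatFunc K) L RatFunc.X := by
  rw [Phi, map_sub, aeval_map_algebraMap, aeval_C]

/-- An étale-closed subfield that contains `t` contains all roots of the `Φ_n` when the place is
not over a post-critical value. -/
theorem isEtaleClosed_eq_top (hφ : 0 < φ.natDegree) (v : HeightOneSpectrum K[X])
    (hv : ∀ ν ∈ postCritSet φ, minpoly K ν ∉ v.asIdeal) (W : ValuationSubring (towerField φ))
    [(v.valuation (RatFunc K)).HasExtension W.valuation]
    {E : IntermediateField (RatFunc K) (towerField φ)} (hE : IsEtaleClosed W E) : E = ⊤ := by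
  have hF : ∀ p : K[X], algebraMap (RatFunc K) (towerField φ) (algebraMap K[X] (RatFunc K) p) ∈ W :=
    fun p => by
      rw [← W.valuation_le_one_iff,
        Valuation.HasExtension.val_map_le_one_iff (v.valuation (RatFunc K))]
      exact v.valuation_le_one p
  have hKF : ∀ a : K, algebraMap (RatFunc K) (towerField φ) (algebraMap K (RatFunc K) a) ∈ W :=
    fun a => hF (C a)
  have hK : ∀ a : K, a ≠ 0 →
      W.valuation (algebraMap (RatFunc K) (towerField φ) (algebraMap K (RatFunc K) a)) = 1 := by
    intro a ha
    refine le_antisymm ((W.valuation_le_one_iff _).2 (hKF a)) ?_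
    have h2 := (W.valuation_le_one_iff _).2 (hKF a⁻¹)
    rw [map_inv₀, map_inv₀, map_inv₀] at h2
    exact (inv_le_one₀ (zero_lt_iff.2 (by simpa using ha))).1 h2
  have hroot : ∀ (n : ℕ) (y : towerField φ), aeval y (Phi φ n) = 0 → y ∈ E := by
    intro n y hy
    have hy' := hy
    rw [aeval_Phi, sub_eq_zero] at hy'
    have hdeg : (Phi φ n).natDegree = (iter φ n).natDegree ∧
        (Phi φ n).leadingCoeff = algebraMap K (RatFunc K) (iter φ n).leadingCoeff := by
      have h1 : (C RatFunc.X : (RatFunc K)[X]).degree <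
          ((iter φ n).map (algebraMap K (RatFunc K))).degree := by
        rw [degree_map]
        refine lt_of_le_of_lt degree_C_le ?_
        exact natDegree_pos_iff_degree_pos.1 (natDegree_iter_pos hφ n)
      rw [Phi]
      exact ⟨by rw [natDegree_sub_C, natDegree_map], by
        rw [leadingCoeff_sub_of_degree_lt h1, leadingCoeff_map]⟩
    have hlead : (iter φ n).leadingCoeff ≠ 0 := by
      rw [leadingCoeff_ne_zero]
      rintro h
      have := natDegree_iter_pos hφ n
      simp [h] at this
    have hc : ∀ i, algebraMap (RatFunc K) (towerField φ) ((Phi φ n).coeff i) ∈ W := fun i => by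
      rw [Phi, coeff_sub, coeff_map, map_sub]
      refine sub_mem (hKF _) ?_
      rw [coeff_C]
      split_ifs
      · rw [← RatFunc.algebraMap_X]
        exact hF X
      · simp
    have hl : W.valuation (algebraMap (RatFunc K) (towerField φ) (Phi φ n).leadingCoeff) = 1 := by
      rw [hdeg.2]
      exact hK _ hlead
    have hyW : y ∈ W := by
      refine mem_valuationSubring_of_monic (E := RatFunc K) W
        (f := C (Phi φ n).leadingCoeff⁻¹ * Phi φ n) ?_ (fun i => ?_) ?_
      · refine monic_C_mul_of_mul_leadingCoeff_eq_one (inv_mul_cancel₀ ?_)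
        rw [hdeg.2]
        simpa using hlead
      · rw [coeff_C_mul, map_mul]
        refine W.mul_mem _ _ ?_ (hc i)
        rw [← W.valuation_le_one_iff, map_inv₀, map_inv₀, hl, inv_one]
      · rw [map_mul, hy, mul_zero]
    have hyK : ∀ p : K[X], aeval y p ∈ W := fun p => by
      induction p using Polynomial.induction_on' with
      | add p q hp hq => rw [map_add]; exact W.add_mem _ _ hp hq
      | monomial k a =>
        rw [aeval_monomial, IsScalarTower.algebraMap_apply K (RatFunc K)]
        exact W.mul_mem _ _ (hKF a) (pow_mem hyW k)
    obtain ⟨g, hg⟩ : ∃ g, v.asIdeal = Ideal.span {g} :=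
      (IsPrincipalIdealRing.principal v.asIdeal).principal
    have hgp : Prime g := by
      rw [← Ideal.span_singleton_prime (fun h => v.ne_bot (by simp [hg, h])), ← hg]
      exact v.isPrime
    -- At a common zero `s`, the point `φ^{∘n}(s)` is both post-critical and a root of `g`, so its
    -- minimal polynomial would lie in `v`.
    have hcop : IsCoprime (g.comp (iter φ n)) (derivative (iter φ n)) := by
      refine (isCoprime_iff_aeval_ne_zero_of_isAlgClosed (k := K) (AlgebraicClosure K) _ _).2
        fun s => ?_
      by_contra! hs
      refine hv _ (aeval_iter_mem_postCritSet hs.2) ?_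
      rw [hg, Ideal.mem_span_singleton]
      rw [aeval_comp] at hs
      exact (minpoly.irreducible (Algebra.IsIntegral.isIntegral _)).dvd_symm hgp.irreducible
        (minpoly.dvd K _ hs.1)
    have hd : W.valuation (aeval y (derivative (iter φ n))) = 1 := by
      -- Evaluating the Bézout identity at `y` turns `g ∘ φ^{∘n}` into `g(t)`, which has value below
      -- one; the derivative cannot also have value below one.
      refine le_antisymm ((W.valuation_le_one_iff _).2 (hyK _)) ?_
      by_contra! hlt
      obtain ⟨a, b, hab⟩ := hcop
      have h1 := congrArg (fun p => W.valuation (aeval y p)) hab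
      have h2 : W.valuation (aeval y (g.comp (iter φ n))) < 1 := by
        rw [aeval_comp, hy', ← RatFunc.algebraMap_X, aeval_algebraMap_apply,
          aeval_algebraMap_apply, aeval_X_left, AlgHom.id_apply,
          Valuation.HasExtension.val_map_lt_one_iff (v.valuation (RatFunc K)),
          v.valuation_lt_one_iff_mem, hg]
        exact Ideal.mem_span_singleton_self g
      simp only [map_add, map_mul, map_one] at h1
      have h3 : ∀ (p : K[X]) (z : towerField φ), W.valuation z < 1 →
          W.valuation (aeval y p * z) < 1 := fun p z hz => by
        rw [map_mul]
        exact mul_lt_one_of_nonneg_of_lt_one_right ((W.valuation_le_one_iff _).2 (hyK p))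
          zero_le hz
      exact absurd h1 (ne_of_lt (Valuation.map_add_lt _ (h3 a _ h2) (h3 b _ hlt)))
    refine hE.mem (g := (Phi φ n).map (algebraMap (RatFunc K) E)) (fun i => ?_) ?_ ?_ ?_
    · rw [coeff_map, ← IsScalarTower.algebraMap_apply]
      exact hc i
    · rw [leadingCoeff_map, ← IsScalarTower.algebraMap_apply]
      exact hl
    · rw [aeval_map_algebraMap, hy]
    · rw [derivative_map, aeval_map_algebraMap, Phi, derivative_sub, derivative_C, sub_zero,
        derivative_map, aeval_map_algebraMap, hd]
  rw [eq_top_iff]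
  have h1 : towerField φ ≤ E.map (towerField φ).val := by
    refine IntermediateField.adjoin_le_iff.2 ?_
    rintro x ⟨n, hx⟩
    have hxL : x ∈ towerField φ := IntermediateField.subset_adjoin _ _ ⟨n, hx⟩
    refine ⟨⟨x, hxL⟩, hroot n ⟨x, hxL⟩ ?_, rfl⟩
    apply Subtype.val_injective
    have := aeval_algebraMap_apply (AlgebraicClosure (RatFunc K)) (⟨x, hxL⟩ : towerField φ) (Phi φ n)
    exact this.symm.trans hx
  intro x _
  obtain ⟨y, hy, hyx⟩ := h1 x.2
  rwa [← Subtype.val_injective hyx]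

/-- The tower of a post-critically finite polynomial is finitely ramified. -/
theorem finitelyRamified_of_isPCF [PerfectField K] (hφ : derivative φ ≠ 0) (h : IsPCF φ) :
    FinitelyRamifiedOverRat K (towerField φ) := by
  have hpos := natDegree_pos_of_derivative_ne_zero hφ
  -- Besides infinity, only places under post-critical points can ramify.
  have hsub : {P : RatPlace K | ¬ UnramifiedIn P.1.valuation (towerField φ)} ⊆
      {P | RatFunc.X ∉ P.1} ∪ ⋃ ν ∈ postCritSet φ, {P | RatFunc.X ∈ P.1 ∧
        algebraMap K[X] (RatFunc K) (minpoly K ν) ∈ P.1.nonunits} := by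
    intro P hP
    by_contra hnot
    simp only [Set.mem_union, Set.mem_ofPred_eq, Set.mem_iUnion, not_or, not_not, not_exists,
      not_and, exists_prop] at hnot
    refine hP ?_
    obtain ⟨v, hv, hv'⟩ := P.exists_heightOneSpectrum hnot.1
    have hp : PerfectField (IsLocalRing.ResidueField P.1.valuation.valuationSubring) := by
      rw [P.1.valuationSubring_valuation, ← hv]
      exact perfectField_residueField_of_polynomial v
    refine unramifiedIn_of_values _ fun W hW x => ?_
    have : (v.valuation (RatFunc K)).HasExtension W.valuation := hasExtension_of_comap_eq (by
      rw [hv, comap_eq_of_hasExtension P.1.valuation W, P.1.valuationSubring_valuation])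
    obtain ⟨E, hE, hEv⟩ := exists_isEtaleClosed_of_heightOne (F := RatFunc K) v W
    refine hEv x ?_
    rw [isEtaleClosed_eq_top hpos v (fun ν hν => ?_) W hE]
    · trivial
    · rw [hv']
      exact hnot.2 ν hν hnot.1
  refine Set.Finite.subset ?_ hsub
  refine Set.Finite.union (Set.Subsingleton.finite fun P hP Q hQ => RatPlace.eq_of_X_notMem hP hQ)
    ((postCritSet_finite hφ h).biUnion fun ν hν => Set.Subsingleton.finite fun P hP Q hQ =>
      RatPlace.eq_of_irreducible hP.1 hQ.1
        (minpoly.irreducible (Algebra.IsIntegral.isIntegral ν)) hP.2 hQ.2)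

end TowerRoots

/-! ### Finitely ramified implies post-critically finite -/

section NotPCF

variable {K : Type*} [Field K] {φ : K[X]}

theorem not_isAlgebraic_of_aeval_iter {L : Type*} [Field L] [Algebra (RatFunc K) L] [Algebra K L]
    [IsScalarTower K (RatFunc K) L] {n : ℕ} {x : L}
    (hx : aeval x (iter φ n) = algebraMap (RatFunc K) L RatFunc.X) : ¬ IsAlgebraic K x := by
  intro h
  have h1 : IsAlgebraic K (aeval x (iter φ n)) := IsIntegral.isAlgebraic (adjoin_le_integralClosure
    h.isIntegral (aeval_mem_adjoin_singleton K x))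
  rw [hx, isAlgebraic_algebraMap_iff (algebraMap (RatFunc K) L).injective] at h1
  exact RatFunc.transcendental_X h1

/-- The image of a critical point under an iterate gives a ramified place. -/
theorem exists_ramified_place [PerfectField K] (hφ : derivative φ ≠ 0) {r : AlgebraicClosure K}
    (hr : r ∈ critPoints φ) (n : ℕ) :
    ∃ P : RatPlace K, RatFunc.X ∈ P.1 ∧ ¬ UnramifiedIn P.1.valuation (towerField φ) ∧
      algebraMap K[X] (RatFunc K) (minpoly K ((polyMap φ)^[n + 1] r)) ∈ P.1.nonunits := by
  have hpos := natDegree_pos_of_derivative_ne_zero hφ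
  set ν := (polyMap φ)^[n + 1] r with hν
  set g := minpoly K ν
  set h := minpoly K r
  have hg : Irreducible g := minpoly.irreducible (Algebra.IsIntegral.isIntegral ν)
  have hh : Irreducible h := minpoly.irreducible (Algebra.IsIntegral.isIntegral r)
  obtain ⟨x₀, hx₀⟩ := IsAlgClosed.exists_aeval_eq_zero (AlgebraicClosure (RatFunc K))
    (Phi φ (n + 1)) (by
      have h1 := natDegree_iter_pos hpos (n + 1)
      have h2 : (Phi φ (n + 1)).natDegree = (iter φ (n + 1)).natDegree := by
        rw [Phi, natDegree_sub_C, natDegree_map]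
      rw [← h2] at h1
      exact (natDegree_pos_iff_degree_pos.1 h1).ne')
  obtain ⟨x, hx⟩ : ∃ x : towerField φ, aeval x (iter φ (n + 1)) =
      algebraMap (RatFunc K) (towerField φ) RatFunc.X := by
    refine ⟨⟨x₀, IntermediateField.subset_adjoin _ _ ⟨n + 1, hx₀⟩⟩, ?_⟩
    rw [← sub_eq_zero, ← aeval_Phi]
    apply Subtype.val_injective
    exact (aeval_algebraMap_apply (AlgebraicClosure (RatFunc K)) (_ : towerField φ) _).symm.trans hx₀
  have hxt : ¬ IsAlgebraic K x := not_isAlgebraic_of_aeval_iter hx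
  have hinj : ∀ p : K[X], aeval x p = 0 → p = 0 := fun p hp => by
    by_contra h0
    exact hxt ⟨p, h0, hp⟩
  let A : Subring (towerField φ) := (aeval (R := K) x).range.toSubring
  -- As `x` is transcendental over `K`, the ring `K[x]` is a polynomial ring and `h(x)` is not a
  -- unit of it; `W` is a valuation ring of the tower in which `h(x)` is a non-unit.
  obtain ⟨W, hAW, hIW⟩ := Ideal.image_subset_nonunits_valuationSubring (A := A)
    (Ideal.span {⟨aeval x h, h, rfl⟩}) (by
      rw [Ne, Ideal.eq_top_iff_one, Ideal.mem_span_singleton]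
      rintro ⟨⟨_, q, rfl⟩, hq⟩
      have h1 : aeval x (1 - h * q) = 0 := by
        rw [map_sub, map_mul, map_one, sub_eq_zero]
        exact congrArg Subtype.val hq
      exact hh.not_isUnit (IsUnit.of_mul_eq_one q (sub_eq_zero.1 (hinj _ h1)).symm))
  have hpW : ∀ p : K[X], aeval x p ∈ W := fun p => hAW ⟨p, rfl⟩
  have hhW : W.valuation (aeval x h) < 1 := by
    rw [← W.mem_nonunits_iff]
    exact hIW ⟨_, Ideal.mem_span_singleton_self _, rfl⟩
  -- `r` is a multiple zero of the composite, and `h` is separable because `K` is perfect.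
  have hdvd : h ^ 2 ∣ g.comp (iter φ (n + 1)) := by
    have hr0 : aeval r (g.comp (iter φ (n + 1))) = 0 := by
      rw [aeval_comp, aeval_iter]
      exact minpoly.aeval K ν
    have hr1 : aeval r (derivative (g.comp (iter φ (n + 1)))) = 0 := by
      rw [derivative_comp, map_mul, aeval_derivative_iter_succ_eq_zero hr, zero_mul]
    obtain ⟨q, hq⟩ := minpoly.dvd K r hr0
    have hsep : aeval r (derivative h) ≠ 0 :=
      (PerfectField.separable_of_irreducible hh).aeval_derivative_ne_zero (minpoly.aeval K r)
    rw [hq, derivative_mul, map_add, map_mul, map_mul, minpoly.aeval, zero_mul, add_zero,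
      mul_eq_zero] at hr1
    rw [hq, sq]
    exact mul_dvd_mul_left _ (minpoly.dvd K r (hr1.resolve_left hsep))
  have hgt : algebraMap (RatFunc K) (towerField φ) (algebraMap K[X] (RatFunc K) g) =
      aeval x (g.comp (iter φ (n + 1))) := by
    rw [aeval_comp, hx, ← RatFunc.algebraMap_X, aeval_algebraMap_apply, aeval_algebraMap_apply,
      aeval_X_left, AlgHom.id_apply]
  have hgW : W.valuation (algebraMap (RatFunc K) (towerField φ) (algebraMap K[X] (RatFunc K) g)) ≤
      W.valuation (aeval x h) ^ 2 := by
    obtain ⟨q, hq⟩ := hdvd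
    rw [hgt, hq, map_mul, map_mul, map_pow, map_pow]
    exact mul_le_of_le_one_right' ((W.valuation_le_one_iff _).2 (hpW q))
  have hgn : algebraMap K[X] (RatFunc K) g ∈
      (W.comap (algebraMap (RatFunc K) (towerField φ))).nonunits := by
    rw [ValuationSubring.mem_nonunits_iff_or, ValuationSubring.mem_comap, map_inv₀]
    have h1 := lt_of_le_of_lt hgW (pow_lt_one₀ zero_le hhW two_ne_zero)
    rw [← W.mem_nonunits_iff, W.mem_nonunits_iff_or] at h1
    simpa using h1
  let P : RatPlace K := ⟨W.comap (algebraMap (RatFunc K) (towerField φ)), fun a => by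
      rw [ValuationSubring.mem_comap, ← IsScalarTower.algebraMap_apply]
      simpa using hpW (C a), fun htop => by
      rw [htop, ValuationSubring.mem_nonunits_iff_or] at hgn
      rcases hgn with h0 | h0
      · exact hg.ne_zero (by simpa using h0)
      · exact h0 trivial⟩
  have hX : RatFunc.X ∈ P.1 := by
    change algebraMap (RatFunc K) (towerField φ) RatFunc.X ∈ W
    rw [← hx]
    exact hpW _
  refine ⟨P, hX, fun hunr => ?_, hgn⟩
  obtain ⟨v, hv, hv'⟩ := P.exists_heightOneSpectrum hX
  have : (v.valuation (RatFunc K)).HasExtension W.valuation := hasExtension_of_comap_eq hv.symm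
  have : P.1.valuation.HasExtension W.valuation :=
    hasExtension_of_comap_eq P.1.valuationSubring_valuation.symm
  -- If unramified, `h(x)` has the value of some `y` in `K(t)`. Then `y` lies in the maximal ideal,
  -- generated by `g`, so its value is at most that of `g`, hence at most the square of its own
  -- value.
  obtain ⟨y, hy⟩ := (hunr W).1 (aeval x h)
  have hhW0 : W.valuation (aeval x h) ≠ 0 := by
    rw [Valuation.ne_zero_iff]
    exact fun h0 => hh.ne_zero (hinj h h0)
  have hspan : v.asIdeal = Ideal.span {g} :=
    ((PrincipalIdealRing.isMaximal_of_irreducible hg).eq_of_le v.isPrime.ne_top (by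
      rw [Ideal.span_singleton_le_iff_mem, hv']; exact hgn)).symm
  have hyv : v.valuation (RatFunc K) y < 1 := by
    rw [← Valuation.HasExtension.val_map_lt_one_iff (v.valuation (RatFunc K)) W.valuation, hy]
    exact hhW
  obtain ⟨m, d, hmd⟩ := v.exists_primeCompl_mul_eq_of_integer y hyv.le
  have hd1 : v.valuation (RatFunc K) (algebraMap K[X] (RatFunc K) d) = 1 :=
    (v.valuation_eq_one_iff_notMem).2 d.2
  have hm : m ∈ v.asIdeal := by
    refine (v.valuation_lt_one_iff_mem (K := RatFunc K) m).1 ?_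
    change v.valuation (RatFunc K) (algebraMap K[X] (RatFunc K) m) < 1
    rwa [← hmd, map_mul, hd1, mul_one]
  rw [hspan, Ideal.mem_span_singleton] at hm
  obtain ⟨q, rfl⟩ := hm
  have h1 := congrArg (fun z => W.valuation (algebraMap (RatFunc K) (towerField φ) z)) hmd
  simp only [map_mul] at h1
  rw [(Valuation.HasExtension.val_map_eq_one_iff (v.valuation (RatFunc K)) W.valuation _).2 hd1,
    mul_one, hy] at h1
  have hq : W.valuation (algebraMap (RatFunc K) (towerField φ) (algebraMap K[X] (RatFunc K) q)) ≤ 1 :=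
    (Valuation.HasExtension.val_map_le_one_iff (v.valuation (RatFunc K)) W.valuation _).2
      (v.valuation_le_one q)
  have h2 : W.valuation (aeval x h) ≤ W.valuation (aeval x h) ^ 2 :=
    h1.le.trans ((mul_le_of_le_one_right' hq).trans hgW)
  rw [sq] at h2
  exact absurd (le_of_mul_le_mul_left (by rwa [mul_one] : W.valuation (aeval x h) * 1 ≤ _)
    (zero_lt_iff.2 hhW0)) (not_le.2 hhW)

/-- A polynomial whose tower is finitely ramified is post-critically finite. -/
theorem isPCF_of_finitelyRamified [PerfectField K] (hφ : derivative φ ≠ 0)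
    (hfin : FinitelyRamifiedOverRat K (towerField φ)) : IsPCF φ := by
  classical
  intro r hr
  by_contra hper
  have hinj := iterate_injective_of_not_isPreperiodic hper
  choose P hXP hP hgP using fun n => exists_ramified_place hφ hr n
  have : Finite {P : RatPlace K | ¬ UnramifiedIn P.1.valuation (towerField φ)} := hfin
  -- By the pigeonhole principle one place `Q` serves infinitely many `n`. Coprime polynomials
  -- cannot both vanish at `Q`, so all these orbit points are roots of the single polynomial `g`.
  obtain ⟨⟨Q, hQ⟩, hinf⟩ := Finite.exists_infinite_fiber
    fun n => (⟨P n, hP n⟩ : {P : RatPlace K | ¬ UnramifiedIn P.1.valuation (towerField φ)})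
  have hinf' : (({n | P n = Q} : Set ℕ)).Infinite := by
    rw [← Set.infinite_coe_iff]
    convert hinf using 2
    ext n
    simp
  obtain ⟨m, hm⟩ := hinf'.nonempty
  set g := minpoly K ((polyMap φ)^[m + 1] r)
  have hg : g ≠ 0 := minpoly.ne_zero (Algebra.IsIntegral.isIntegral _)
  refine hinf' (Set.Finite.of_finite_image (f := fun n => (polyMap φ)^[n + 1] r)
    ((g.aroots (AlgebraicClosure K)).toFinset.finite_toSet.subset ?_)
    fun a _ b _ hab => Nat.succ_injective (hinj hab))
  rintro _ ⟨n, hn, rfl⟩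
  rw [Finset.mem_coe, Multiset.mem_toFinset, mem_aroots]
  refine ⟨hg, ?_⟩
  have h1 := hgP n
  have h2 := hgP m
  rw [show P n = Q from hn] at h1
  rw [show P m = Q from hm] at h2
  by_contra hne
  have hcop : IsCoprime (minpoly K ((polyMap φ)^[n + 1] r)) g := by
    rw [(minpoly.irreducible (Algebra.IsIntegral.isIntegral _)).coprime_iff_not_dvd]
    rintro ⟨q, hq⟩
    exact hne (by rw [hq, map_mul, minpoly.aeval, zero_mul])
  obtain ⟨a, b, hab⟩ := hcop
  obtain ⟨v, -, hv⟩ := Q.exists_heightOneSpectrum ((show P m = Q from hm) ▸ hXP m)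
  refine v.isPrime.ne_top ((Ideal.eq_top_iff_one _).2 ?_)
  rw [← hab]
  exact add_mem (Ideal.mul_mem_left _ _ ((hv _).2 h1)) (Ideal.mul_mem_left _ _ ((hv _).2 h2))

end NotPCF

/-! ### Extension of valuation rings -/

section ExtendValuations

/-- Valuation subrings extend along field extensions. -/
theorem exists_comap_eq {F L : Type*} [Field F] [Field L] [Algebra F L] (V : ValuationSubring F) :
    ∃ W : ValuationSubring L, W.comap (algebraMap F L) = V := by
  let f : V →+* L := (algebraMap F L).comp V.subtype
  -- Locality of `V → W` prevents `W` from contracting to more than `V`: if `x ∉ V` became integral,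
  -- `x⁻¹` would be a unit of `W` and therefore of `V`.
  obtain ⟨W, hW, hloc⟩ := IsLocalRing.exists_factor_valuationRing f
  refine ⟨W, ValuationSubring.ext _ _ fun x => ⟨fun hx => ?_, fun hx => hW ⟨x, hx⟩⟩⟩
  by_contra hxV
  have hx0 : x ≠ 0 := by
    rintro rfl
    exact hxV V.zero_mem
  have hinv : x⁻¹ ∈ V := (V.mem_or_inv_mem x).resolve_left hxV
  have hu : IsUnit (f.codRestrict W.toSubring hW ⟨x⁻¹, hinv⟩) :=
    isUnit_iff_exists_inv.2 ⟨⟨algebraMap F L x, hx⟩, Subtype.ext (by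
      change algebraMap F L x⁻¹ * algebraMap F L x = 1
      rw [← map_mul, inv_mul_cancel₀ hx0, map_one])⟩
  obtain ⟨⟨y, hy⟩, hxy⟩ := isUnit_iff_exists_inv.1 (hloc.map_nonunit _ hu)
  have h1 : x⁻¹ * y = 1 := congrArg Subtype.val hxy
  refine hxV ?_
  rwa [show x = y by rw [inv_mul_eq_one₀ hx0] at h1; exact h1]

end ExtendValuations

/-! ### Unramifiedness over number fields and conditions at almost all places -/

section NumberField

variable {K : Type*} [Field K] [NumberField K]

/-- A subfield of the algebraic closure that is contained in all étale-closed subfields with the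
same value group is unramified. -/
theorem unramifiedIn_of_le (v : HeightOneSpectrum (𝓞 K))
    (M : IntermediateField K (AlgebraicClosure K))
    (h : ∀ (W : ValuationSubring (AlgebraicClosure K)) [(v.valuation K).HasExtension W.valuation]
      (E : IntermediateField K (AlgebraicClosure K)), IsEtaleClosed W E → M ≤ E) :
    UnramifiedIn (v.valuation K) M := by
  have : Finite (𝓞 K ⧸ v.asIdeal) := Ideal.finiteQuotientOfFreeOfNeBot v.asIdeal v.ne_bot
  have := perfectField_residueField_of_finite (F := K) v
  refine unramifiedIn_of_values _ fun W' hW' x => ?_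
  -- The étale-closed fields live in the algebraic closure, so the valuation of `M` is first
  -- extended there.
  obtain ⟨W, hW⟩ := exists_comap_eq (L := AlgebraicClosure K) W'
  have : (v.valuation K).HasExtension W.valuation := hasExtension_of_comap_eq (by
    rw [← comap_eq_of_hasExtension (v.valuation K) W', ← hW, ValuationSubring.comap_comap]
    rfl)
  obtain ⟨E, hE, hEv⟩ := exists_isEtaleClosed_of_heightOne (F := K) v W
  obtain ⟨y, hy⟩ := hEv x (h W E hE x.2)
  refine ⟨y, ?_⟩
  have : W'.valuation.HasExtension W.valuation :=
    hasExtension_of_comap_eq (by rw [hW, W'.valuationSubring_valuation])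
  rw [← Valuation.HasExtension.val_map_eq_iff W'.valuation W.valuation]
  exact hy

/-- The finitely many coefficients of the minimal polynomial are integral at almost all `v`;
integrality then holds for every extension of `v`. -/
theorem eventually_mem (z : AlgebraicClosure K) : ∀ᶠ v : HeightOneSpectrum (𝓞 K) in Filter.cofinite,
    ∀ (W : ValuationSubring (AlgebraicClosure K)) [(v.valuation K).HasExtension W.valuation],
      z ∈ W := by
  have h1 : ∀ᶠ v : HeightOneSpectrum (𝓞 K) in Filter.cofinite,
      ∀ i ∈ (minpoly K z).support, v.valuation K ((minpoly K z).coeff i) ≤ 1 := by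
    rw [Filter.eventually_all_finset]
    intro i _
    simp only [Filter.eventually_cofinite, not_le]
    exact HeightOneSpectrum.Support.finite (𝓞 K) ((minpoly K z).coeff i)
  filter_upwards [h1] with v hv W _
  refine mem_valuationSubring_of_monic W (minpoly.monic (Algebra.IsIntegral.isIntegral z))
    (fun i => ?_) (minpoly.aeval K z)
  by_cases hi : i ∈ (minpoly K z).support
  · rw [← W.valuation_le_one_iff, Valuation.HasExtension.val_map_le_one_iff (v.valuation K)]
    exact hv i hi
  · rw [notMem_support_iff.1 hi, map_zero]
    exact W.zero_mem

/-- A nonzero algebraic number is a unit at almost all places. -/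
theorem eventually_valuation_eq_one {z : AlgebraicClosure K} (hz : z ≠ 0) :
    ∀ᶠ v : HeightOneSpectrum (𝓞 K) in Filter.cofinite,
      ∀ (W : ValuationSubring (AlgebraicClosure K)) [(v.valuation K).HasExtension W.valuation],
        W.valuation z = 1 := by
  filter_upwards [eventually_mem z, eventually_mem z⁻¹] with v h1 h2 W _
  refine le_antisymm ((W.valuation_le_one_iff _).2 (h1 W)) ?_
  have := (W.valuation_le_one_iff _).2 (h2 W)
  rw [map_inv₀] at this
  exact (inv_le_one₀ (zero_lt_iff.2 (by simpa using hz))).1 this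

/-- An algebraic number is unramified at almost all places. -/
theorem eventually_mem_isEtaleClosed (z : AlgebraicClosure K) :
    ∀ᶠ v : HeightOneSpectrum (𝓞 K) in Filter.cofinite,
      ∀ (W : ValuationSubring (AlgebraicClosure K)) [(v.valuation K).HasExtension W.valuation]
        (E : IntermediateField K (AlgebraicClosure K)), IsEtaleClosed W E → z ∈ E := by
  have hsep : aeval z (derivative (minpoly K z)) ≠ 0 :=
    (PerfectField.separable_of_irreducible (minpoly.irreducible
      (Algebra.IsIntegral.isIntegral z))).aeval_derivative_ne_zero (minpoly.aeval K z)
  have hc : ∀ᶠ v : HeightOneSpectrum (𝓞 K) in Filter.cofinite,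
      ∀ i ∈ (minpoly K z).support,
      ∀ (W : ValuationSubring (AlgebraicClosure K)) [(v.valuation K).HasExtension W.valuation],
        algebraMap K (AlgebraicClosure K) ((minpoly K z).coeff i) ∈ W :=
    (Filter.eventually_all_finset _).2 fun i _ => eventually_mem _
  filter_upwards [eventually_valuation_eq_one hsep, hc] with v hv hc W _ E hE
  refine hE ((minpoly K z).map (algebraMap K E))
    ((minpoly.monic (Algebra.IsIntegral.isIntegral z)).map _) (fun i => ?_) z ?_ ?_
  · rw [coeff_map, ← IsScalarTower.algebraMap_apply]
    by_cases hi : i ∈ (minpoly K z).support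
    · exact hc i hi W
    · rw [notMem_support_iff.1 hi, map_zero]
      exact W.zero_mem
  · rw [aeval_map_algebraMap, minpoly.aeval]
  · rw [derivative_map, aeval_map_algebraMap]
    exact hv W

end NumberField

/-! ### Hensel's lemma for the Newton–Puiseux equation -/

section Hensel

variable {k : Type*} [Field k]

open scoped PowerSeries in
/-- A simple zero of the leading form of `z ^ e * ψ (PowerSeries.X ^ M * z) = β` lifts to a power
series. -/
theorem exists_powerSeries_root {e M : ℕ} (he : (e : k) ≠ 0) (hM : 0 < M) (ψ : k[X])
    (β : k⟦X⟧) {z₀ : k} (hψ : ψ.coeff 0 ≠ 0) (hz₀ : z₀ ≠ 0)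
    (h : ψ.coeff 0 * z₀ ^ e = PowerSeries.constantCoeff β) :
    ∃ z : k⟦X⟧, PowerSeries.constantCoeff z = z₀ ∧
      z ^ e * (ψ.map (PowerSeries.C (R := k))).eval (PowerSeries.X ^ M * z) = β := by
  have he0 : e ≠ 0 := fun h => he (by rw [h, Nat.cast_zero])
  have hb : PowerSeries.constantCoeff β ≠ 0 := by
    rw [← h]
    exact mul_ne_zero hψ (pow_ne_zero _ hz₀)
  have hββ : β * β⁻¹ = 1 := PowerSeries.mul_inv_cancel β hb
  set D := ψ.natDegree
  -- The equation need not be monic in `z`. Put `w = z⁻¹`, multiply by `w ^ (e + D)` and divide by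
  -- `β`: this gives the monic equation `G(w) = 0`. Modulo the variable it reads `w ^ (e + D) = z₀⁻¹
  -- ^ e * w ^ D`.
  let S : k⟦X⟧[X] := ∑ i ∈ Finset.range (D + 1),
    Polynomial.C (β⁻¹ * (PowerSeries.C (ψ.coeff i) * PowerSeries.X ^ (M * i))) * Polynomial.X ^ (D - i)
  let G : k⟦X⟧[X] := Polynomial.X ^ (e + D) - S
  have hSdeg : S.degree < ((e + D : ℕ) : WithBot ℕ) := by
    refine (degree_sum_le _ _).trans_lt ?_
    rw [Finset.sup_lt_iff (WithBot.bot_lt_coe _)]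
    intro i _
    refine (degree_C_mul_X_pow_le _ _).trans_lt ?_
    exact_mod_cast (by omega : D - i < e + D)
  have hG : G.Monic := monic_X_pow_sub hSdeg
  have hGmap : G.map (PowerSeries.constantCoeff (R := k)) = Polynomial.X ^ (e + D) -
      Polynomial.C ((PowerSeries.constantCoeff β)⁻¹ * ψ.coeff 0) * Polynomial.X ^ D := by
    simp only [G, S, Polynomial.map_sub, Polynomial.map_pow, Polynomial.map_X, Polynomial.map_sum,
      Polynomial.map_mul, Polynomial.map_C]
    congr 1
    rw [Finset.sum_eq_single 0]
    · simp
    · intro i _ hi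
      simp [hM.ne', hi]
    · simp
  have hw : (PowerSeries.constantCoeff β)⁻¹ * ψ.coeff 0 = (z₀⁻¹) ^ e := by
    rw [← h, mul_inv, inv_pow, mul_comm, ← mul_assoc, mul_inv_cancel₀ hψ, one_mul]
  have hev : ∀ (p : k⟦X⟧[X]) (a : k), PowerSeries.constantCoeff (p.eval (PowerSeries.C a)) =
      (p.map (PowerSeries.constantCoeff (R := k))).eval a := fun p a => by
    conv_rhs => rw [← PowerSeries.constantCoeff_C a]
    rw [eval_map, eval₂_hom]
  obtain ⟨w, hw0, hwI⟩ := HenselianRing.is_henselian (I := Ideal.span {(PowerSeries.X : k⟦X⟧)}) G hG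
    (PowerSeries.C z₀⁻¹) (by
      rw [Ideal.mem_span_singleton, PowerSeries.X_dvd_iff, hev, hGmap, hw]
      simp [pow_add]) (by
      refine IsUnit.map _ ?_
      rw [PowerSeries.isUnit_iff_constantCoeff, isUnit_iff_ne_zero, hev, ← derivative_map, hGmap,
        hw]
      -- The derivative at `w = z₀⁻¹` is `e * w ^ (e + D - 1)`; the case `D = 0` is separate because
      -- of the truncated exponent `D - 1`.
      have : e + D - 1 = e + (D - 1) ∨ D = 0 := by omega
      have hfin : (e : k) * z₀⁻¹ ^ (e + D - 1) ≠ 0 := mul_ne_zero he (pow_ne_zero _ (inv_ne_zero hz₀))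
      convert hfin using 1
      simp only [derivative_sub, derivative_X_pow, derivative_C_mul, eval_sub, eval_mul, eval_C,
        eval_pow, eval_X, Nat.cast_add]
      rcases this with h1 | h1
      · rw [h1, pow_add]
        simp
        ring
      · rw [h1]
        simp)
  have hwc : PowerSeries.constantCoeff w = z₀⁻¹ := by
    rw [Ideal.mem_span_singleton, PowerSeries.X_dvd_iff, map_sub, PowerSeries.constantCoeff_C, sub_eq_zero] at hwI
    exact hwI
  have hwne : PowerSeries.constantCoeff w ≠ 0 := by rw [hwc]; exact inv_ne_zero hz₀
  have hww : w * w⁻¹ = 1 := PowerSeries.mul_inv_cancel w hwne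
  refine ⟨w⁻¹, by rw [PowerSeries.constantCoeff_inv, hwc, inv_inv], ?_⟩
  have hG0 : w ^ (e + D) = ∑ i ∈ Finset.range (D + 1),
      β⁻¹ * (PowerSeries.C (ψ.coeff i) * PowerSeries.X ^ (M * i)) * w ^ (D - i) := by
    have h1 := hw0
    simp only [G, S, IsRoot.def, eval_sub, eval_pow, eval_X, eval_finsetSum, eval_mul, eval_C] at h1
    exact sub_eq_zero.1 h1
  have hψe : (ψ.map (PowerSeries.C (R := k))).eval (PowerSeries.X ^ M * w⁻¹) * w ^ D =
      ∑ i ∈ Finset.range (D + 1), PowerSeries.C (ψ.coeff i) * PowerSeries.X ^ (M * i) * w ^ (D - i) := by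
    rw [eval_map, eval₂_eq_sum_range, Finset.sum_mul]
    refine Finset.sum_congr rfl fun i hi => ?_
    have hi' : i + (D - i) = D := by have := Finset.mem_range.1 hi; omega
    have h2 : w⁻¹ ^ i * w ^ D = w ^ (D - i) := by
      conv_lhs => rw [← hi', pow_add, ← mul_assoc, ← mul_pow, mul_comm w⁻¹, hww, one_pow, one_mul]
    rw [mul_pow, ← pow_mul, ← h2]
    ring
  have hfin : w ^ (e + D) * (w⁻¹ ^ e * (ψ.map (PowerSeries.C (R := k))).eval (PowerSeries.X ^ M * w⁻¹)) =
      w ^ (e + D) * β := by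
    have h3 : w ^ (e + D) * (w⁻¹ ^ e * (ψ.map (PowerSeries.C (R := k))).eval (PowerSeries.X ^ M * w⁻¹)) =
        (w * w⁻¹) ^ e * ((ψ.map (PowerSeries.C (R := k))).eval (PowerSeries.X ^ M * w⁻¹) * w ^ D) := by
      rw [mul_pow]; ring
    rw [h3, hww, one_pow, one_mul, hψe, hG0, Finset.sum_mul]
    refine Finset.sum_congr rfl fun i _ => ?_
    linear_combination (-(PowerSeries.C (ψ.coeff i) * PowerSeries.X ^ (M * i) * w ^ (D - i))) * hββ
  exact mul_left_cancel₀ (pow_ne_zero _ (fun h0 => hwne (by rw [h0, map_zero]))) hfin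

end Hensel

/-! ### Puiseux series inside Hahn series -/

section Puiseux

open scoped PowerSeries

variable {k : Type*} [Field k]

/-- The embedding of power series into Hahn series over `ℚ` that sends the variable to the `N`-th
root of the variable. -/
noncomputable def puiseux (k : Type*) [Field k] (N : ℕ) (hN : 0 < N) : k⟦X⟧ →+* HahnSeries ℚ k :=
  (HahnSeries.embDomainRingHom ((AddMonoidHom.mulRight (N : ℚ)⁻¹).comp (Nat.castAddMonoidHom ℚ))
    (fun m n h => by
      have hN' : (N : ℚ)⁻¹ ≠ 0 := by positivity
      exact Nat.cast_injective (mul_right_cancel₀ hN' h))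
    (fun m n => by
      have hN' : (0 : ℚ) < (N : ℚ)⁻¹ := by positivity
      exact (mul_le_mul_iff_left₀ hN').trans Nat.cast_le)).comp
  (HahnSeries.toPowerSeries (R := k)).symm.toRingHom

theorem coeff_puiseux {N : ℕ} (hN : 0 < N) (α : k⟦X⟧) {n : ℕ} {q : ℚ} (hq : q = n / N) :
    (puiseux k N hN α).coeff q = PowerSeries.coeff n α := by
  subst hq
  rw [div_eq_mul_inv]
  exact HahnSeries.embDomain_coeff

theorem coeff_puiseux_of_ne {N : ℕ} (hN : 0 < N) (α : k⟦X⟧) {q : ℚ} (hq : ∀ n : ℕ, q ≠ n / N) :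
    (puiseux k N hN α).coeff q = 0 := by
  refine HahnSeries.embDomain_of_notMem_range ?_
  rintro ⟨n, hn⟩
  exact hq n (by rw [div_eq_mul_inv]; exact hn.symm)

theorem exists_puiseux_eq {N : ℕ} (hN : 0 < N) {a : HahnSeries ℚ k}
    (ha : ∀ q, a.coeff q ≠ 0 → ∃ n : ℕ, q = n / N) : ∃ α, puiseux k N hN α = a := by
  refine ⟨PowerSeries.mk fun n => a.coeff (n / N), ?_⟩
  ext q
  by_cases hq : ∃ n : ℕ, q = n / N
  · obtain ⟨n, hn⟩ := hq
    rw [coeff_puiseux hN _ hn, PowerSeries.coeff_mk, hn]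
  · rw [coeff_puiseux_of_ne hN _ (not_exists.1 hq)]
    by_contra h
    exact hq (ha q (Ne.symm h))

theorem puiseux_C {N : ℕ} (hN : 0 < N) (c : k) :
    puiseux k N hN (PowerSeries.C c) = HahnSeries.C c := by
  ext q
  by_cases hq : ∃ n : ℕ, q = n / N
  · obtain ⟨n, hn⟩ := hq
    rw [coeff_puiseux hN _ hn, PowerSeries.coeff_C, HahnSeries.C_apply, HahnSeries.coeff_single]
    have : q = 0 ↔ n = 0 := by
      rw [hn, div_eq_zero_iff]
      simp [hN.ne']
    simp only [this]
  · rw [coeff_puiseux_of_ne hN _ (not_exists.1 hq), HahnSeries.C_apply,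
      HahnSeries.coeff_single_of_ne]
    rintro rfl
    exact hq ⟨0, by simp⟩

/-- A Puiseux series of nonnegative order whose constant term is `a₀`, and whose leading term after
the constant term is `b * T ^ q`. -/
structure HasLeadingTerms (a : HahnSeries ℚ k) (a₀ b : k) (q : ℚ) : Prop where
  isPuiseux : ∃ N : ℕ, 0 < N ∧ ∀ s, a.coeff s ≠ 0 → ∃ n : ℕ, s = n / N
  coeff_zero : a.coeff 0 = a₀
  pos : 0 < q
  coeff_eq : a.coeff q = b
  coeff_eq_zero : ∀ s, 0 < s → s < q → a.coeff s = 0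

/-- The Newton–Puiseux step: a zero of the leading form lifts to a Puiseux series. -/
theorem HasLeadingTerms.exists_root {a : HahnSeries ℚ k} {a₀ b : k} {q : ℚ}
    (ha : HasLeadingTerms a a₀ b q) {φ p : k[X]} {r z₀ : k} {e : ℕ} (he : (e : k) ≠ 0)
    (hφ : φ - C a₀ = (X - C r) ^ e * p) (hp : p.eval r ≠ 0) (hz₀ : z₀ ≠ 0)
    (hb : p.eval r * z₀ ^ e = b) :
    ∃ x, (φ.map HahnSeries.C).eval x = a ∧ HasLeadingTerms x r z₀ (q / e) := by
  have he0 : 0 < e := Nat.pos_of_ne_zero fun h => he (by rw [h, Nat.cast_zero])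
  have hb0 : b ≠ 0 := by
    rw [← hb]
    exact mul_ne_zero hp (pow_ne_zero _ hz₀)
  obtain ⟨⟨N, hN, hsupp⟩, h0, hq, hab, hlt⟩ := ha
  obtain ⟨m, hm⟩ := hsupp q (by rw [hab]; exact hb0)
  have hNQ : (0 : ℚ) < N := by exact_mod_cast hN
  have heQ : (0 : ℚ) < e := by exact_mod_cast he0
  have hm0 : 0 < m := by
    rcases Nat.eq_zero_or_pos m with h | h
    · rw [hm, h] at hq
      simp at hq
    · exact h
  have hNe : 0 < N * e := Nat.mul_pos hN he0
  -- The denominator `N * e` accommodates `q / e`. With `S = T^{1/(N e)}` and `q = m / N`, the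
  -- series is `a₀ + S^{m e} β` and the solution is sought as `r + S^m z`. Dividing by `S^{m e}`
  -- leaves `z^e p(r + S^m z) = β`.
  obtain ⟨α, hα⟩ := exists_puiseux_eq hNe (a := a) fun s hs => by
    obtain ⟨n, hn⟩ := hsupp s hs
    exact ⟨n * e, by rw [hn]; push_cast; field_simp⟩
  have hαc : ∀ n : ℕ, PowerSeries.coeff n α = a.coeff (n / (N * e : ℕ)) := fun n => by
    rw [← hα, coeff_puiseux hNe α rfl]
  have hdvd : PowerSeries.X ^ (m * e) ∣ α - PowerSeries.C a₀ := by
    rw [PowerSeries.X_pow_dvd_iff]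
    intro n hn
    rw [map_sub, PowerSeries.coeff_C, hαc]
    rcases Nat.eq_zero_or_pos n with h | h
    · simp [h, h0]
    · rw [if_neg h.ne', sub_zero]
      refine hlt _ (by positivity) ?_
      rw [hm, div_lt_div_iff₀ (by positivity) hNQ]
      push_cast
      have : (n : ℚ) < m * e := by exact_mod_cast hn
      calc (n : ℚ) * N < m * e * N := mul_lt_mul_of_pos_right this hNQ
        _ = m * (N * e) := by ring
  obtain ⟨β, hβ⟩ := hdvd
  have hβ0 : PowerSeries.constantCoeff β = b := by
    have h1 : PowerSeries.coeff (m * e) (α - PowerSeries.C a₀) = PowerSeries.constantCoeff β := by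
      rw [hβ]
      have := PowerSeries.coeff_X_pow_mul β (m * e) 0
      rwa [zero_add, PowerSeries.coeff_zero_eq_constantCoeff_apply] at this
    rw [← h1, map_sub, PowerSeries.coeff_C, if_neg (by positivity), sub_zero, hαc, ← hab, hm]
    congr 1
    push_cast
    field_simp
  obtain ⟨z, hz, hzβ⟩ := exists_powerSeries_root he hm0 (taylor r p) β
    (by rwa [taylor_coeff_zero]) hz₀ (by rw [taylor_coeff_zero, hb, hβ0])
  have hxc : ∀ n : ℕ, PowerSeries.coeff n (PowerSeries.C r + PowerSeries.X ^ m * z) =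
      (if n = 0 then r else 0) + if m ≤ n then PowerSeries.coeff (n - m) z else 0 := fun n => by
    rw [map_add, PowerSeries.coeff_C, PowerSeries.coeff_X_pow_mul']
  refine ⟨puiseux k (N * e) hNe (PowerSeries.C r + PowerSeries.X ^ m * z), ?_,
    ⟨N * e, hNe, fun s hs => ?_⟩, ?_, by positivity, ?_, fun s hs0 hsq => ?_⟩
  · have h1 : (φ.map (PowerSeries.C (R := k))).eval (PowerSeries.C r + PowerSeries.X ^ m * z) = α := by
      have h2 : φ = C a₀ + (X - C r) ^ e * p := by rw [← hφ]; ring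
      have h3 : (p.map (PowerSeries.C (R := k))).eval (PowerSeries.C r + PowerSeries.X ^ m * z) =
          ((taylor r p).map (PowerSeries.C (R := k))).eval (PowerSeries.X ^ m * z) := by
        rw [map_taylor, taylor_eval, add_comm]
      rw [h2]
      simp only [Polynomial.map_add, Polynomial.map_mul, Polynomial.map_pow, Polynomial.map_sub,
        Polynomial.map_C, Polynomial.map_X, eval_add, eval_mul, eval_pow, eval_sub, eval_C, eval_X,
        h3]
      rw [add_sub_cancel_left, mul_pow, ← pow_mul, mul_assoc, hzβ, ← hβ]
      ring
    rw [← hα, ← h1, eval_map, eval_map, hom_eval₂]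
    congr 1
    refine RingHom.ext fun c => ?_
    exact (puiseux_C hNe c).symm
  · by_contra hno
    exact hs (coeff_puiseux_of_ne hNe _ (not_exists.1 hno))
  · rw [coeff_puiseux hNe _ (n := 0) (q := 0) (by simp), hxc]
    simp [hm0.ne']
  · rw [coeff_puiseux hNe _ (n := m) (q := q / e) (by rw [hm]; push_cast; field_simp), hxc]
    simp [hm0.ne', hz]
  · by_cases hno : ∃ n : ℕ, s = n / (N * e : ℕ)
    · obtain ⟨n, hn⟩ := hno
      rw [coeff_puiseux hNe _ hn, hxc]
      have hn0 : n ≠ 0 := by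
        rintro rfl
        rw [hn] at hs0
        simp at hs0
      have hnm : n < m := by
        rw [hn, hm, div_div, Nat.cast_mul, div_lt_div_iff_of_pos_right (by positivity)] at hsq
        exact_mod_cast hsq
      simp [hn0, hnm]
    · exact coeff_puiseux_of_ne hNe _ (not_exists.1 hno)

end Puiseux

/-! ### Counting Puiseux solutions -/

section PuiseuxSplitting

variable {k : Type*} [Field k]

/-- Sets `D` of constant terms and `U` of leading coefficients that are stable under the
Newton–Puiseux algorithm for the equations `φ(x) = a`. -/
structure PuiseuxClosed (φ : k[X]) (D U : Set k) : Prop where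
  zero_notMem : (0 : k) ∉ U
  splits : ∀ a₀ ∈ D, (φ - C a₀).Splits
  root_mem : ∀ a₀ ∈ D, ∀ r, φ.eval r = a₀ → r ∈ D
  leading : ∀ a₀ ∈ D, ∀ (r : k) (e : ℕ) (p : k[X]), 0 < e → φ - C a₀ = (X - C r) ^ e * p →
    p.eval r ≠ 0 → ∀ b ∈ U, (X ^ e - C (b / p.eval r)).Splits ∧
      ∀ z, p.eval r * z ^ e = b → z ∈ U

/-- A Puiseux series with constant term in `D` and next coefficient in `U`. -/
def IsPuiseuxGood (D U : Set k) (a : HahnSeries ℚ k) : Prop :=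
  ∃ a₀ ∈ D, ∃ b ∈ U, ∃ q, HasLeadingTerms a a₀ b q

variable [CharZero k] {φ : k[X]} {D U : Set k}

/-- All solutions of `φ(x) = a` are Puiseux series. -/
theorem PuiseuxClosed.splits_sub (h : PuiseuxClosed φ D U) (hφ : 0 < φ.natDegree)
    {a : HahnSeries ℚ k} (ha : IsPuiseuxGood D U a) :
    (φ.map HahnSeries.C - C a).Splits ∧
      ∀ x, (φ.map HahnSeries.C).eval x = a → IsPuiseuxGood D U x := by
  classical
  obtain ⟨a₀, ha₀, b, hb, q, hlead⟩ := ha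
  have hb0 : b ≠ 0 := fun h0 => h.zero_notMem (h0 ▸ hb)
  set f := φ - C a₀ with hf
  have hfdeg : f.natDegree = φ.natDegree := natDegree_sub_C
  have hf0 : f ≠ 0 := fun h0 => by rw [h0, natDegree_zero] at hfdeg; omega
  have hfac : ∀ r : k, ∃ p : k[X], f = (X - C r) ^ (f.rootMultiplicity r) * p ∧ p.eval r ≠ 0 := by
    intro r
    obtain ⟨p, hp, hnd⟩ := exists_eq_pow_rootMultiplicity_mul_and_not_dvd f hf0 r
    exact ⟨p, hp, fun h0 => hnd (dvd_iff_isRoot.2 h0)⟩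
  choose p hp hpr using hfac
  set e : k → ℕ := fun r => f.rootMultiplicity r
  set Z : k → k[X] := fun r => X ^ (e r) - C (b / (p r).eval r)
  -- The pairs index the expected solutions: a root `r` of `φ - a₀` together with a leading
  -- coefficient `z` such that `p(r) z^e = b`.
  set Sg : Finset (Σ _ : k, k) := f.roots.toFinset.sigma fun r => (Z r).roots.toFinset
  have he : ∀ r ∈ f.roots.toFinset, 0 < e r := fun r hr => by
    rw [Multiset.mem_toFinset, mem_roots hf0] at hr
    exact (rootMultiplicity_pos hf0).2 hr
  have hZroot : ∀ s ∈ Sg, 0 < e s.1 ∧ (p s.1).eval s.1 * s.2 ^ e s.1 = b := by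
    rintro ⟨r, z⟩ hs
    rw [Finset.mem_sigma] at hs
    have her := he r hs.1
    refine ⟨her, ?_⟩
    have h2 := hs.2
    rw [Multiset.mem_toFinset, mem_roots (X_pow_sub_C_ne_zero her _), IsRoot.def, eval_sub, eval_pow,
      eval_X, eval_C, sub_eq_zero] at h2
    change (p r).eval r * z ^ e r = b
    rw [show z ^ e r = _ from h2, mul_div_cancel₀ _ (hpr r)]
  have hex : ∀ s ∈ Sg, ∃ x, (φ.map HahnSeries.C).eval x = a ∧
      HasLeadingTerms x s.1 s.2 (q / e s.1) := fun s hs => by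
    obtain ⟨h1, h2⟩ := hZroot s hs
    refine hlead.exists_root (Nat.cast_ne_zero.2 h1.ne') (hp s.1) (hpr s.1) ?_ h2
    intro h0
    rw [h0, zero_pow h1.ne', mul_zero] at h2
    exact hb0 h2.symm
  choose! x hx hxlead using hex
  have hinj : Set.InjOn x Sg := by
    rintro ⟨r, z⟩ hs ⟨r', z'⟩ hs' hxx
    have h1 : r = r' := (hxlead _ hs).coeff_zero.symm.trans
      ((congrArg (fun y => y.coeff 0) hxx).trans (hxlead _ hs').coeff_zero)
    subst h1
    have h2 : z = z' := (hxlead _ hs).coeff_eq.symm.trans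
      ((congrArg (fun y => y.coeff (q / e r)) hxx).trans (hxlead _ hs').coeff_eq)
    rw [h2]
  have hfsplits : f.Splits := h.splits a₀ ha₀
  have hcardZ : ∀ r ∈ f.roots.toFinset, (Z r).roots.toFinset.card = e r := fun r hr => by
    have hne : b / (p r).eval r ≠ 0 := div_ne_zero hb0 (hpr r)
    have hsep : (Z r).Separable := separable_X_pow_sub_C _ (Nat.cast_ne_zero.2 (he r hr).ne') hne
    rw [Multiset.toFinset_card_of_nodup (nodup_roots hsep),
      ← (h.leading a₀ ha₀ r (e r) (p r) (he r hr) (hp r) (hpr r) b hb).1.natDegree_eq_card_roots,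
      natDegree_X_pow_sub_C]
  -- Over each `r` there are exactly `e r` distinct `z`, and the multiplicities add up to the
  -- degree. The resulting solutions are distinct, so there are no others.
  have hcard : Sg.card = φ.natDegree := by
    rw [Finset.card_sigma, Finset.sum_congr rfl hcardZ, ← hfdeg, hfsplits.natDegree_eq_card_roots,
      ← Multiset.toFinset_sum_count_eq]
    exact Finset.sum_congr rfl fun r _ => (count_roots f).symm
  set g := φ.map (HahnSeries.C (Γ := ℚ)) - C a with hg
  have hgdeg : g.natDegree = φ.natDegree := by rw [hg, natDegree_sub_C, natDegree_map]
  have hg0 : g ≠ 0 := fun h0 => by rw [h0, natDegree_zero] at hgdeg; omega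
  have hsub : Sg.image x ⊆ g.roots.toFinset := fun y hy => by
    obtain ⟨s, hs, rfl⟩ := Finset.mem_image.1 hy
    rw [Multiset.mem_toFinset, mem_roots hg0, IsRoot.def, hg, eval_sub, eval_C, hx s hs, sub_self]
  have hcardim : (Sg.image x).card = φ.natDegree := by rw [Finset.card_image_of_injOn hinj, hcard]
  have h1 := Multiset.toFinset_card_le g.roots
  have h2 := g.card_roots'
  have h3 := Finset.card_le_card hsub
  refine ⟨splits_iff_card_roots.2 (by omega), fun y hy => ?_⟩
  have heq : Sg.image x = g.roots.toFinset := Finset.eq_of_subset_of_card_le hsub (by omega)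
  have hymem : y ∈ Sg.image x := by
    rw [heq, Multiset.mem_toFinset, mem_roots hg0, IsRoot.def, hg, eval_sub, eval_C, hy, sub_self]
  obtain ⟨s, hs, rfl⟩ := Finset.mem_image.1 hymem
  have hs' := Finset.mem_sigma.1 hs
  have hr := hs'.1
  rw [Multiset.mem_toFinset, mem_roots hf0, hf, IsRoot.def, eval_sub, eval_C, sub_eq_zero] at hr
  exact ⟨s.1, h.root_mem a₀ ha₀ _ hr, s.2, (h.leading a₀ ha₀ s.1 (e s.1) (p s.1) (hZroot s hs).1
    (hp s.1) (hpr s.1) b hb).2 _ (hZroot s hs).2, _, hxlead s hs⟩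

/-- All solutions of `φ^{∘n}(x) = a` are Puiseux series. -/
theorem PuiseuxClosed.splits_iter_sub (h : PuiseuxClosed φ D U) (hφ : 0 < φ.natDegree) (n : ℕ)
    {a : HahnSeries ℚ k} (ha : IsPuiseuxGood D U a) :
    ((iter φ n).map HahnSeries.C - C a).Splits := by
  induction n generalizing a with
  | zero =>
    rw [iter_zero, Polynomial.map_X]
    exact Splits.X_sub_C a
  | succ n ih =>
    obtain ⟨hs, hroots⟩ := h.splits_sub hφ ha
    set g := φ.map (HahnSeries.C (Γ := ℚ)) - C a with hg
    have h1 : (iter φ (n + 1)).map (HahnSeries.C (Γ := ℚ)) - C a =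
        g.comp ((iter φ n).map HahnSeries.C) := by
      rw [iter_succ, Polynomial.map_comp, hg, sub_comp, C_comp]
    have hg0 : g ≠ 0 := fun h0 => by
      have : g.natDegree = φ.natDegree := by rw [hg, natDegree_sub_C, natDegree_map]
      rw [h0, natDegree_zero] at this
      omega
    -- Factoring the outermost `φ - a` reduces the claim to `φ^{∘n} - x` for the solutions `x`,
    -- which are again good.
    rw [h1, hs.eq_prod_roots, mul_comp, C_comp, multiset_prod_comp, Multiset.map_map]
    refine Splits.C_mul (Splits.multisetProd fun y hy => ?_) _
    obtain ⟨x, hx, rfl⟩ := Multiset.mem_map.1 hy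
    rw [mem_roots hg0, hg, IsRoot.def, eval_sub, eval_C, sub_eq_zero] at hx
    rw [Function.comp_apply, sub_comp, X_comp, C_comp]
    exact ih (hroots x hx)

end PuiseuxSplitting

/-! ### Hahn series of nonnegative order -/

section HahnIntegers

variable (k : Type*) [Field k]

/-- The Hahn series of nonnegative order. -/
noncomputable def hahnIntegers : ValuationSubring (HahnSeries ℚ k) where
  carrier := {a | ∀ s < 0, a.coeff s = 0}
  mul_mem' := by
    intro a b ha hb s hs
    rw [HahnSeries.coeff_mul]
    refine Finset.sum_eq_zero fun ij hij => ?_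
    have h1 := (Finset.mem_antidiagonal.1 hij).2.2
    by_cases hi : ij.1 < 0
    · rw [ha _ hi, zero_mul]
    · rw [hb ij.2 (by linarith), mul_zero]
  one_mem' := fun s hs => by rw [HahnSeries.coeff_one, if_neg hs.ne]
  add_mem' := fun {a b} ha hb s hs => by rw [HahnSeries.coeff_add, ha s hs, hb s hs, add_zero]
  zero_mem' := fun _ _ => rfl
  neg_mem' := fun {a} ha s hs => by rw [HahnSeries.coeff_neg, ha s hs, neg_zero]
  mem_or_inv_mem' := fun a => by
    by_cases ha0 : a = 0
    · exact Or.inl fun s _ => by rw [ha0, HahnSeries.coeff_zero]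
    have h1 : a.order + a⁻¹.order = 0 := by
      rw [← HahnSeries.order_mul ha0 (inv_ne_zero ha0), mul_inv_cancel₀ ha0, HahnSeries.order_one]
    rcases le_or_gt 0 a.order with h | h
    · exact Or.inl fun s hs => HahnSeries.coeff_eq_zero_of_lt_order (hs.trans_le h)
    · exact Or.inr fun s hs => HahnSeries.coeff_eq_zero_of_lt_order (by linarith)

/-- The constant coefficient of a Hahn series of nonnegative order. -/
noncomputable def hahnConstantCoeff : hahnIntegers k →+* k where
  toFun a := (a : HahnSeries ℚ k).coeff 0
  map_one' := by simp
  map_zero' := rfl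
  map_add' _ _ := rfl
  map_mul' a b := by
    change ((a : HahnSeries ℚ k) * b).coeff 0 = _
    rw [HahnSeries.coeff_mul]
    have key : ∀ ij : ℚ × ℚ, ij ≠ (0, 0) → ij.1 + ij.2 = 0 →
        (a : HahnSeries ℚ k).coeff ij.1 * (b : HahnSeries ℚ k).coeff ij.2 = 0 := by
      rintro ⟨i, j⟩ hne hij
      rcases lt_trichotomy i 0 with hi | hi | hi
      · rw [a.2 i hi, zero_mul]
      · refine absurd ?_ hne
        have : j = 0 := by simpa [hi] using hij
        rw [hi, this]
      · rw [b.2 j (by change i + j = 0 at hij; linarith), mul_zero]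
    rw [Finset.sum_eq_single (0, 0)]
    · intro ij hij hne
      exact key ij hne (Finset.mem_antidiagonal.1 hij).2.2
    · intro hnot
      rw [Finset.mem_antidiagonal] at hnot
      by_contra hne
      exact hnot ⟨left_ne_zero_of_mul hne, right_ne_zero_of_mul hne, add_zero 0⟩

end HahnIntegers

/-! ### Specialization by constant terms -/

section Specialization

theorem iter_map {K k : Type*} [Field K] [Field k] (f : K →+* k) (φ : K[X]) (n : ℕ) :
    (iter φ n).map f = iter (φ.map f) n := by
  induction n with
  | zero => rw [iter_zero, iter_zero, Polynomial.map_X]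
  | succ n ih => rw [iter_succ, iter_succ, Polynomial.map_comp, ih]

variable {K k : Type*} [Field K] [Field k] [Algebra K k]

/-- The embedding of `K[t]` into Hahn series that expands polynomials around `t₀`. -/
noncomputable def expandAt (k : Type*) [Field k] [Algebra K k] (t₀ : K) :
    K[X] →+* HahnSeries ℚ k :=
  (puiseux k 1 one_pos).comp ((Polynomial.coeToPowerSeries.ringHom).comp
    ((mapRingHom (algebraMap K k)).comp (taylorAlgHom t₀).toRingHom))

theorem expandAt_apply (t₀ : K) (p : K[X]) : expandAt k t₀ p =
    puiseux k 1 one_pos (((taylor t₀ p).map (algebraMap K k) : k[X]) : PowerSeries k) := rfl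

theorem expandAt_C (t₀ c : K) : expandAt k t₀ (C c) = HahnSeries.C (algebraMap K k c) := by
  rw [expandAt_apply, taylor_C, Polynomial.map_C, Polynomial.coe_C, puiseux_C]

theorem coeff_expandAt (t₀ : K) (p : K[X]) (n : ℕ) :
    (expandAt k t₀ p).coeff n = algebraMap K k ((taylor t₀ p).coeff n) := by
  rw [expandAt_apply, coeff_puiseux one_pos _ (n := n) (by simp), Polynomial.coeff_coe, coeff_map]

theorem expandAt_injective (t₀ : K) : Function.Injective (expandAt k t₀) := by
  rw [injective_iff_map_eq_zero]
  intro p hp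
  rw [← taylor_eq_zero t₀]
  ext n
  apply (algebraMap K k).injective
  rw [← coeff_expandAt, hp, HahnSeries.coeff_zero, coeff_zero, map_zero]

theorem expandAt_mem (t₀ : K) (p : K[X]) : expandAt k t₀ p ∈ hahnIntegers k := by
  intro s hs
  rw [expandAt_apply, coeff_puiseux_of_ne]
  rintro n rfl
  have : (0 : ℚ) ≤ n / (1 : ℕ) := by positivity
  linarith

/-- This is the expansion `t = t₀ + T`, which starts the Newton–Puiseux recursion. -/
theorem hasLeadingTerms_expandAt_X (t₀ : K) :
    HasLeadingTerms (expandAt k t₀ X) (algebraMap K k t₀) 1 1 := by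
  refine ⟨⟨1, one_pos, fun s hs => ?_⟩, ?_, one_pos, ?_, fun s h0 h1 => ?_⟩
  · by_contra hno
    exact hs (coeff_puiseux_of_ne one_pos _ (not_exists.1 hno))
  · have := coeff_expandAt (k := k) t₀ X 0
    simpa using this
  · have := coeff_expandAt (k := k) t₀ X 1
    simpa [coeff_C] using this
  · refine coeff_puiseux_of_ne one_pos _ ?_
    rintro n rfl
    simp only [Nat.cast_one, div_one] at h0 h1
    have h0' : 0 < n := by exact_mod_cast h0
    have h1' : n < 1 := by exact_mod_cast h1
    omega

/-- If the Newton–Puiseux algorithm at `t₀` does not leave the field `k`, then there is a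
specialization at `t₀` with values in `k`. -/
theorem exists_specialization_of_puiseuxClosed [CharZero k] {φ : K[X]} (hφ : 0 < φ.natDegree)
    {t₀ : K} {D U : Set k} (h : PuiseuxClosed (φ.map (algebraMap K k)) D U)
    (hD : algebraMap K k t₀ ∈ D) (hU : 1 ∈ U) :
    ∃ σ : towerIntegers φ →+* k, ∀ f : K[X],
      σ (algebraMap K[X] (towerIntegers φ) f) = algebraMap K k (f.eval t₀) := by
  let θ : RatFunc K →+* HahnSeries ℚ k := IsFractionRing.lift (expandAt_injective (k := k) t₀)
  have hθ : ∀ p : K[X], θ (algebraMap K[X] (RatFunc K) p) = expandAt k t₀ p :=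
    fun p => IsFractionRing.lift_algebraMap _ p
  let _ : Algebra (RatFunc K) (HahnSeries ℚ k) := θ.toAlgebra
  have hPhi : ∀ n, (Phi φ n).map θ =
      (iter (φ.map (algebraMap K k)) n).map HahnSeries.C - C (expandAt k t₀ X) := fun n => by
    rw [Phi, Polynomial.map_sub, Polynomial.map_map, map_C, ← RatFunc.algebraMap_X, hθ, ← iter_map,
      Polynomial.map_map]
    congr 2
    refine RingHom.ext fun c => ?_
    change θ (algebraMap K (RatFunc K) c) = HahnSeries.C (algebraMap K k c)
    rw [← expandAt_C t₀, ← hθ]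
    rfl
  have hφ' : 0 < (φ.map (algebraMap K k)).natDegree := by rwa [natDegree_map]
  have hPhi0 : ∀ n, Phi φ n ≠ 0 := fun n h0 => by
    have h1 := natDegree_iter_pos hφ n
    have h2 : (Phi φ n).natDegree = (iter φ n).natDegree := by
      rw [Phi, natDegree_sub_C, natDegree_map]
    rw [h0, natDegree_zero] at h2
    omega
  -- The minimal polynomial of each generator divides some `Φ_n`, which splits over the Hahn series.
  obtain ⟨ψ⟩ : Nonempty (towerField φ →ₐ[RatFunc K] HahnSeries ℚ k) := by
    refine IntermediateField.nonempty_algHom_adjoin_of_splits ?_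
    rintro x ⟨n, hx⟩
    have halg : IsAlgebraic (RatFunc K) x := ⟨_, hPhi0 n, hx⟩
    refine ⟨halg.isIntegral, ?_⟩
    refine Splits.of_dvd (g := (Phi φ n).map θ) ?_ ((Polynomial.map_ne_zero_iff θ.injective).2
      (hPhi0 n)) (Polynomial.map_dvd θ (minpoly.dvd _ _ hx))
    rw [hPhi]
    exact h.splits_iter_sub hφ' n ⟨_, hD, 1, hU, 1, hasLeadingTerms_expandAt_X t₀⟩
  have hψ : ∀ p : K[X], ψ (algebraMap K[X] (towerField φ) p) = expandAt k t₀ p := fun p => by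
    rw [IsScalarTower.algebraMap_apply K[X] (RatFunc K), ψ.commutes]
    exact hθ p
  -- Polynomials in `t` expand without negative exponents, so elements integral over them have
  -- nonnegative order and a constant term.
  have hmem : ∀ b : towerIntegers φ, ψ b ∈ hahnIntegers k := by
    rintro ⟨b, f, hf, hfb⟩
    refine mem_valuationSubring_of_monic (E := HahnSeries ℚ k) (hahnIntegers k)
      (hf.map (expandAt k t₀)) (fun i => ?_) (y := ψ b) ?_
    · rw [coeff_map]
      exact expandAt_mem t₀ _
    · rw [coe_aeval_eq_eval, eval_map]
      have h1 := congrArg ψ hfb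
      rw [map_zero] at h1
      rw [← h1, ← AlgHom.coe_toRingHom, hom_eval₂]
      congr 1
      exact RingHom.ext fun p => (hψ p).symm
  let ψ' : towerIntegers φ →+* hahnIntegers k :=
    (ψ.toRingHom.comp (towerIntegers φ).val.toRingHom).codRestrict (hahnIntegers k).toSubring hmem
  refine ⟨(hahnConstantCoeff k).comp ψ', fun f => ?_⟩
  change (ψ (algebraMap K[X] (towerField φ) f)).coeff 0 = _
  have := coeff_expandAt (k := k) t₀ f 0
  rw [hψ]
  rw [taylor_coeff_zero] at this
  simpa using this

end Specialization

/-! ### Independence of the choice of specialization -/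

section Independence

variable {K : Type*} [Field K] {φ : K[X]}

/-- Embeddings over `K(t)` map roots of each `Φ_n` to roots of it. -/
theorem normal_towerField (φ : K[X]) : Normal (RatFunc K) (towerField φ) := by
  rw [IntermediateField.normal_iff_forall_map_le]
  intro f
  rw [towerField, IntermediateField.adjoin_map]
  refine IntermediateField.adjoin.mono _ _ _ ?_
  rintro _ ⟨x, ⟨n, hx⟩, rfl⟩
  refine ⟨n, ?_⟩
  change aeval (f x) (Phi φ n) = 0
  rw [aeval_algHom_apply, hx, map_zero]

/-- The minimal polynomial over `K[t]` of an element of the integral closure of `K[t]` in the tower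
splits over this integral closure. -/
theorem exists_splitting_towerIntegers (b : towerIntegers φ) :
    ∃ (m : K[X][X]) (s : Multiset (towerIntegers φ)), aeval b m = 0 ∧
      m.map (algebraMap K[X] (towerIntegers φ)) = (s.map fun c => X - C c).prod := by
  have := normal_towerField φ
  have hint : IsIntegral K[X] (b : towerField φ) := b.2
  set m := minpoly K[X] (b : towerField φ)
  have hm : m.Monic := minpoly.monic hint
  have hsplit : (m.map (algebraMap K[X] (towerField φ))).Splits := by
    have h1 := Normal.splits (F := RatFunc K) inferInstance (b : towerField φ)
    rw [minpoly.isIntegrallyClosed_eq_field_fractions' (R := K[X]) (RatFunc K) hint,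
      Polynomial.map_map, ← IsScalarTower.algebraMap_eq] at h1
    exact h1
  have hroots : ∀ c ∈ (m.map (algebraMap K[X] (towerField φ))).roots, c ∈ towerIntegers φ := by
    intro c hc
    rw [mem_roots (hm.map _).ne_zero, IsRoot.def, eval_map] at hc
    exact ⟨m, hm, hc⟩
  obtain ⟨s, hs⟩ : ∃ s : Multiset (towerIntegers φ), s.map (towerIntegers φ).val =
      (m.map (algebraMap K[X] (towerField φ))).roots := by
    refine ⟨(m.map (algebraMap K[X] (towerField φ))).roots.attach.map
      fun c => ⟨c.1, hroots c.1 c.2⟩, ?_⟩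
    rw [Multiset.map_map]
    exact Multiset.attach_map_val _
  refine ⟨m, s, ?_, ?_⟩
  · apply Subtype.val_injective
    have h1 := aeval_algebraMap_apply (towerField φ) b m
    exact h1.symm.trans (minpoly.aeval _ _)
  · apply Polynomial.map_injective (towerIntegers φ).val.toRingHom Subtype.val_injective
    rw [Polynomial.map_map, Polynomial.map_multiset_prod, Multiset.map_map]
    have h1 := hsplit.eq_prod_roots_of_monic (hm.map _)
    rw [← hs, Multiset.map_map] at h1
    refine Eq.trans h1 (congrArg Multiset.prod (Multiset.map_congr rfl fun c _ => ?_))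
    simp

/-- Any two specializations at `t₀` have the same image. -/
theorem GlobalSpecialization.field_le {t₀ : K} (σ : GlobalSpecialization φ t₀)
    (E : IntermediateField K (AlgebraicClosure K)) (τ : towerIntegers φ →+* E)
    (hτ : ∀ f : K[X], τ (algebraMap K[X] (towerIntegers φ) f) = algebraMap K E (f.eval t₀)) :
    σ.field ≤ E := by
  rintro _ ⟨b, rfl⟩
  obtain ⟨m, s, hb, hs⟩ := exists_splitting_towerIntegers b
  let τ' : towerIntegers φ →+* AlgebraicClosure K := (algebraMap E (AlgebraicClosure K)).comp τ
  have hcomp : σ.toRingHom.comp (algebraMap K[X] (towerIntegers φ)) =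
      τ'.comp (algebraMap K[X] (towerIntegers φ)) := by
    refine RingHom.ext fun f => ?_
    rw [RingHom.comp_apply, RingHom.comp_apply, σ.map_poly]
    change _ = algebraMap E (AlgebraicClosure K) (τ _)
    rw [hτ, ← IsScalarTower.algebraMap_apply]
  -- Both maps agree on `K[t]`. So `σ(b)` is a root of the image of `m` under `τ'`, a product of
  -- factors `X - τ(c)`, and equals one of the `τ(c)`.
  have h1 : ((m.map (algebraMap K[X] (towerIntegers φ))).map τ').eval (σ.toRingHom b) = 0 := by
    rw [Polynomial.map_map, ← hcomp, ← Polynomial.map_map, eval_map, eval₂_hom, eval_map]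
    exact (congrArg σ.toRingHom hb).trans (map_zero _)
  rw [hs, Polynomial.map_multiset_prod, Multiset.map_map, eval_multiset_prod, Multiset.map_map,
    Multiset.prod_eq_zero_iff] at h1
  obtain ⟨c, -, hc⟩ := Multiset.mem_map.1 h1
  simp only [Function.comp_apply, Polynomial.map_sub, Polynomial.map_X, Polynomial.map_C, eval_sub,
    eval_X, eval_C, sub_eq_zero] at hc
  change σ.toRingHom b ∈ E
  rw [hc]
  exact (τ c).2

end Independence

/-! ### Backward orbits and étale-closed fields -/

section Local

variable {K : Type*} [Field K] {φ : K[X]} {t₀ : K} {W : ValuationSubring (AlgebraicClosure K)}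
  {E : IntermediateField K (AlgebraicClosure K)}

/-- The backward orbit of `t₀` under `φ`. -/
def backwardOrbit (φ : K[X]) (t₀ : K) : Set (AlgebraicClosure K) :=
  {r | ∃ n, aeval r (iter φ n) = algebraMap K (AlgebraicClosure K) t₀}

theorem mem_backwardOrbit_of_aeval_mem {r : AlgebraicClosure K}
    (h : aeval r φ ∈ backwardOrbit φ t₀) : r ∈ backwardOrbit φ t₀ := by
  obtain ⟨n, hn⟩ := h
  exact ⟨n + 1, by rw [aeval_iter_succ', hn]⟩

/-- The local criterion for the stability of étale-closed fields under the Newton–Puiseux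
algorithm. -/
theorem puiseuxClosed_of_isEtaleClosed (hE : IsEtaleClosed W E)
    (hD : backwardOrbit φ t₀ ⊆ E)
    (hlead : ∀ r ∈ backwardOrbit φ t₀, aeval r φ ∈ backwardOrbit φ t₀ →
      ∀ (e : ℕ) (p : (AlgebraicClosure K)[X]), 0 < e →
      φ.map (algebraMap K (AlgebraicClosure K)) - C (aeval r φ) = (X - C r) ^ e * p →
      p.eval r ≠ 0 → W.valuation (p.eval r) = 1 ∧ W.valuation (e : AlgebraicClosure K) = 1) :
    PuiseuxClosed (φ.map (algebraMap K E)) {x : E | (x : AlgebraicClosure K) ∈ backwardOrbit φ t₀}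
      {u : E | W.valuation (u : AlgebraicClosure K) = 1} := by
  have heval : ∀ r : E, (((φ.map (algebraMap K E)).eval r : E) : AlgebraicClosure K) =
      aeval (r : AlgebraicClosure K) φ := fun r => by
    rw [eval_map_algebraMap]
    exact (aeval_algebraMap_apply (AlgebraicClosure K) r φ).symm
  have hmap : (φ.map (algebraMap K E)).map (algebraMap E (AlgebraicClosure K)) =
      φ.map (algebraMap K (AlgebraicClosure K)) := by
    rw [Polynomial.map_map, ← IsScalarTower.algebraMap_eq]
  refine ⟨fun h => ?_, fun a₀ ha₀ => ?_, fun a₀ ha₀ r hr => ?_,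
    fun a₀ ha₀ r e p he hfac hpr b hb => ?_⟩
  · have h' : W.valuation (0 : AlgebraicClosure K) = 1 := h
    simp at h'
  · refine Splits.of_splits_map (algebraMap E (AlgebraicClosure K)) (IsAlgClosed.splits _)
      fun r hr => ?_
    have hr' := isRoot_of_mem_roots hr
    rw [IsRoot.def, Polynomial.map_sub, hmap, Polynomial.map_C, eval_sub, eval_C, eval_map_algebraMap,
      sub_eq_zero] at hr'
    exact ⟨⟨r, hD (mem_backwardOrbit_of_aeval_mem (by rw [hr']; exact ha₀))⟩, rfl⟩
  · refine mem_backwardOrbit_of_aeval_mem ?_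
    rw [← heval, hr]
    exact ha₀
  · have hra : (φ.map (algebraMap K E)).eval r = a₀ := by
      have := congrArg (eval r) hfac
      rw [eval_sub, eval_C, eval_mul, eval_pow, eval_sub, eval_X, eval_C, sub_self,
        zero_pow he.ne', zero_mul, sub_eq_zero] at this
      exact this
    have hra' : aeval (r : AlgebraicClosure K) φ = a₀ := by rw [← heval, hra]
    have hpe : ((p.eval r : E) : AlgebraicClosure K) =
        (p.map (algebraMap E (AlgebraicClosure K))).eval (r : AlgebraicClosure K) :=
      (eval_map_apply (algebraMap E (AlgebraicClosure K)) r).symm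
    obtain ⟨hc, hev⟩ := hlead r (mem_backwardOrbit_of_aeval_mem (by rw [hra']; exact ha₀))
      (by rw [hra']; exact ha₀) e (p.map (algebraMap E (AlgebraicClosure K))) he (by
        have := congrArg (Polynomial.map (algebraMap E (AlgebraicClosure K))) hfac
        rw [Polynomial.map_sub, hmap, Polynomial.map_C, Polynomial.map_mul, Polynomial.map_pow,
          Polynomial.map_sub, Polynomial.map_X, Polynomial.map_C] at this
        rw [hra']
        exact this) (by
        rw [← hpe]
        exact fun h => hpr (Subtype.val_injective h))
    rw [← hpe] at hc
    have hb' : W.valuation (b : AlgebraicClosure K) = 1 := hb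
    have hbc : W.valuation ((b / p.eval r : E) : AlgebraicClosure K) = 1 := by
      change W.valuation ((b : AlgebraicClosure K) / (p.eval r : E)) = 1
      rw [map_div₀, hb', hc, div_one]
    have hone : ∀ z : AlgebraicClosure K, z ^ e = (b / p.eval r : E) → W.valuation z = 1 := by
      intro z hz
      rw [← hz, map_pow] at hbc
      exact (pow_eq_one_iff.1 hbc).resolve_right he.ne'
    refine ⟨?_, fun z hz => hone z ?_⟩
    · refine Splits.of_splits_map (algebraMap E (AlgebraicClosure K)) (IsAlgClosed.splits _)
        fun z hz => ?_
      have hz' := isRoot_of_mem_roots hz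
      rw [IsRoot.def, Polynomial.map_sub, Polynomial.map_pow, Polynomial.map_X, Polynomial.map_C,
        eval_sub, eval_pow, eval_X, eval_C, sub_eq_zero] at hz'
      -- The derivative at `z` is `e z^{e-1}`, a unit since `e` and `z` are units; so `E` contains
      -- `z`.
      refine ⟨⟨z, hE (X ^ e - C (b / p.eval r)) (monic_X_pow_sub_C _ he.ne') (fun i => ?_) z ?_ ?_⟩,
        rfl⟩
      · rw [coeff_sub, coeff_X_pow, coeff_C, map_sub]
        refine sub_mem ?_ ?_
        · split_ifs
          · rw [map_one]; exact W.one_mem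
          · rw [map_zero]; exact W.zero_mem
        · split_ifs
          · exact (W.valuation_le_one_iff _).1 hbc.le
          · rw [map_zero]; exact W.zero_mem
      · rw [map_sub, map_pow, aeval_X, aeval_C, sub_eq_zero]
        exact hz'
      · rw [derivative_sub, derivative_C, sub_zero, derivative_X_pow, map_mul, map_pow, aeval_X,
          aeval_C, map_natCast, map_mul, map_pow, hev, hone z hz', one_pow, one_mul]
    · have h1 : z ^ e = b / p.eval r := by rw [← hz, mul_div_cancel_left₀ _ hpr]
      rw [← h1]
      rfl

/-- At a zero `r` of `φ - a₀` that is simple, the factorization of `φ - a₀` is determined by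
`φ'(r)`. -/
theorem eq_one_of_derivative_ne_zero {A : Type*} [Field A] {f p : A[X]} {a₀ r : A} {e : ℕ}
    (he : 0 < e) (hf : f - C a₀ = (X - C r) ^ e * p) (hr : (derivative f).eval r ≠ 0) :
    e = 1 ∧ p.eval r = (derivative f).eval r := by
  have h1 := congrArg (fun g => (derivative g).eval r) hf
  simp only [derivative_sub, derivative_C, sub_zero, derivative_mul, derivative_X_sub_C_pow,
    eval_add, eval_mul, eval_pow, eval_sub, eval_X, eval_C, sub_self, zero_pow he.ne', zero_mul,
    add_zero] at h1
  have he1 : e = 1 := by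
    by_contra hne
    rw [zero_pow (by omega : e - 1 ≠ 0)] at h1
    rw [h1, mul_zero, zero_mul] at hr
    exact hr rfl
  refine ⟨he1, ?_⟩
  rw [h1, he1]
  simp

/-- Divisibility of `φ(r) - φ(s)` by `r - s` persists over `W`, so `φ` does not increase distances
between integral points. -/
theorem exists_mul_eq_aeval_sub (hc : ∀ i, algebraMap K (AlgebraicClosure K) (φ.coeff i) ∈ W)
    {r s : AlgebraicClosure K} (hr : r ∈ W) (hs : s ∈ W) :
    ∃ c ∈ W, aeval r φ - aeval s φ = (r - s) * c := by
  obtain ⟨q, hq⟩ : ∃ q : W[X], q.map (algebraMap W (AlgebraicClosure K)) =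
      φ.map (algebraMap K (AlgebraicClosure K)) := by
    rw [← mem_lifts, lifts_iff_coeff_lifts]
    intro n
    rw [coeff_map]
    exact ⟨⟨_, hc n⟩, rfl⟩
  have hev : ∀ x : W, ((q.eval x : W) : AlgebraicClosure K) = aeval (x : AlgebraicClosure K) φ :=
    fun x => by
      rw [← eval_map_algebraMap, ← hq]
      exact (eval_map_apply (algebraMap W (AlgebraicClosure K)) x).symm
  obtain ⟨c, hcc⟩ := sub_dvd_eval_sub (⟨r, hr⟩ : W) ⟨s, hs⟩ q
  refine ⟨c, c.2, ?_⟩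
  have h1 := congrArg (fun w : W => (w : AlgebraicClosure K)) hcc
  simpa [hev] using h1

/-- `r` is a root of `φ - φ(r)`, which becomes monic and integral after division by a unit. -/
theorem mem_of_aeval_mem (hc : ∀ i, algebraMap K (AlgebraicClosure K) (φ.coeff i) ∈ W)
    (hl : W.valuation (algebraMap K (AlgebraicClosure K) φ.leadingCoeff) = 1)
    (hφ : 0 < φ.natDegree) {r : AlgebraicClosure K} (hr : aeval r φ ∈ W) : r ∈ W := by
  set f := φ.map (algebraMap K (AlgebraicClosure K)) - C (aeval r φ)
  have hlead : f.leadingCoeff = algebraMap K (AlgebraicClosure K) φ.leadingCoeff := by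
    rw [leadingCoeff_sub_of_degree_lt, leadingCoeff_map]
    rw [degree_map]
    exact degree_C_le.trans_lt (natDegree_pos_iff_degree_pos.1 hφ)
  have hl0 : f.leadingCoeff ≠ 0 := fun h => by
    rw [← hlead, h] at hl
    simp at hl
  refine mem_valuationSubring_of_monic (E := AlgebraicClosure K) W (f := C f.leadingCoeff⁻¹ * f)
    (monic_C_mul_of_mul_leadingCoeff_eq_one (inv_mul_cancel₀ hl0)) (fun i => ?_) ?_
  · rw [coeff_C_mul, coeff_sub, coeff_map, coeff_C]
    refine W.mul_mem _ _ ?_ (sub_mem (hc i) ?_)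
    · rw [← W.valuation_le_one_iff, hlead, map_inv₀, hl, inv_one]
    · split_ifs
      · exact hr
      · exact W.zero_mem
  · rw [map_mul, map_sub, aeval_map_algebraMap, aeval_C]
    simp

theorem leadingCoeff_derivative_eq [CharZero K] (φ : K[X]) :
    (derivative φ).leadingCoeff = φ.leadingCoeff * φ.natDegree := by
  rcases Nat.eq_zero_or_pos φ.natDegree with h | h
  · rw [natDegree_eq_zero.1 h |>.choose_spec.symm]
    simp
  · rw [leadingCoeff, natDegree_eq_of_degree_eq_some (degree_derivative h.ne'), coeff_derivative,
      Nat.sub_add_cancel h, ← Nat.cast_succ, Nat.succ_eq_add_one, Nat.sub_add_cancel h,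
      leadingCoeff]

variable [CharZero K]

/-- Critical points are integral because `φ'` has leading coefficient `a * d`, a unit; `φ` preserves
integrality along their orbits. -/
theorem postCritSet_subset (hc : ∀ i, algebraMap K (AlgebraicClosure K) (φ.coeff i) ∈ W)
    (hl : W.valuation (algebraMap K (AlgebraicClosure K) φ.leadingCoeff) = 1)
    (hd : W.valuation (φ.natDegree : AlgebraicClosure K) = 1) {ν : AlgebraicClosure K}
    (hν : ν ∈ postCritSet φ) : ν ∈ W := by
  obtain ⟨r, hr, n, rfl⟩ := hν
  have hev : ∀ x ∈ W, aeval x φ ∈ W := fun x hx => by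
    obtain ⟨c, hcW, hcx⟩ := exists_mul_eq_aeval_sub hc hx W.zero_mem
    rw [sub_zero, sub_eq_iff_eq_add] at hcx
    rw [hcx]
    refine W.add_mem _ _ (W.mul_mem _ _ hx hcW) ?_
    rw [← coeff_zero_eq_aeval_zero']
    exact hc 0
  induction n with
  | zero =>
    have hl' : W.valuation (algebraMap K (AlgebraicClosure K) (derivative φ).leadingCoeff) = 1 := by
      rw [leadingCoeff_derivative_eq, map_mul, map_mul, hl, map_natCast, hd, one_mul]
    refine mem_of_aeval_mem (fun i => ?_) hl' (Nat.pos_of_ne_zero fun h => ?_)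
      (r := r) (by rw [show aeval r (derivative φ) = 0 from hr]; exact W.zero_mem)
    · rw [coeff_derivative, map_mul]
      refine W.mul_mem _ _ (hc _) ?_
      rw [← Nat.cast_succ, map_natCast]
      exact natCast_mem W _
    · obtain ⟨c, hc0⟩ := natDegree_eq_zero.1 h
      have hr' : aeval r (derivative φ) = 0 := hr
      rw [← hc0, aeval_C] at hr'
      rw [← hc0, leadingCoeff_C, hr'] at hl'
      simp at hl'
  | succ n ih =>
    rw [Function.iterate_succ_apply']
    exact hev _ ih

/-- The derivative of `φ` is a unit at a point that stays away from the critical points. -/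
theorem valuation_derivative_eq_one
    (hl : W.valuation (algebraMap K (AlgebraicClosure K) φ.leadingCoeff) = 1)
    (hd : W.valuation (φ.natDegree : AlgebraicClosure K) = 1) {r : AlgebraicClosure K}
    (hr : ∀ c ∈ critPoints φ, W.valuation (r - c) = 1) :
    W.valuation (aeval r (derivative φ)) = 1 := by
  have h1 := (IsAlgClosed.splits
    ((derivative φ).map (algebraMap K (AlgebraicClosure K)))).eval_eq_prod_roots r
  rw [eval_map_algebraMap, leadingCoeff_map, leadingCoeff_derivative_eq] at h1
  rw [h1, map_mul, map_mul, map_mul, hl, map_natCast, hd, one_mul, one_mul, map_multiset_prod,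
    Multiset.map_map]
  refine Multiset.prod_eq_one fun x hx => ?_
  obtain ⟨c, hc, rfl⟩ := Multiset.mem_map.1 hx
  refine hr c ?_
  have := isRoot_of_mem_roots hc
  rwa [IsRoot.def, eval_map_algebraMap] at this

/-- Preimages of points that stay away from the post-critical set. -/
theorem preimage_of_valuation_sub_eq_one (hE : IsEtaleClosed W E)
    (hc : ∀ i, algebraMap K (AlgebraicClosure K) (φ.coeff i) ∈ W)
    (hl : W.valuation (algebraMap K (AlgebraicClosure K) φ.leadingCoeff) = 1)
    (hd : W.valuation (φ.natDegree : AlgebraicClosure K) = 1) (hφ : 0 < φ.natDegree)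
    {r : AlgebraicClosure K} (hrW : aeval r φ ∈ W) (hrE : aeval r φ ∈ E)
    (hr : ∀ ν ∈ postCritSet φ, W.valuation (aeval r φ - ν) = 1) :
    r ∈ W ∧ r ∈ E ∧ (∀ ν ∈ postCritSet φ, W.valuation (r - ν) = 1) ∧
      W.valuation (aeval r (derivative φ)) = 1 := by
  have hrW' := mem_of_aeval_mem hc hl hφ hrW
  -- If `r` met `ν` modulo `W`, then `φ(r)` would meet `φ(ν)`, which is post-critical as well.
  have hν : ∀ ν ∈ postCritSet φ, W.valuation (r - ν) = 1 := fun ν hν => by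
    have hνW := postCritSet_subset hc hl hd hν
    obtain ⟨c, hcW, hcr⟩ := exists_mul_eq_aeval_sub hc hrW' hνW
    have h1 := hr _ (polyMap_mem_postCritSet hν)
    rw [hcr, map_mul] at h1
    have h2 := (W.valuation_le_one_iff _).2 hcW
    have h3 := (W.valuation_le_one_iff _).2 (W.sub_mem hrW' hνW)
    exact le_antisymm h3 (h1 ▸ mul_le_of_le_one_right' h2)
  have hder := valuation_derivative_eq_one hl hd fun c hc =>
    hν c (critPoints_subset_postCritSet hc)
  refine ⟨hrW', ?_, hν, hder⟩
  let z : E := ⟨_, hrE⟩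
  have hlead : (φ.map (algebraMap K E) - C z).leadingCoeff =
      algebraMap K E φ.leadingCoeff := by
    rw [leadingCoeff_sub_of_degree_lt, leadingCoeff_map]
    rw [degree_map]
    exact degree_C_le.trans_lt (natDegree_pos_iff_degree_pos.1 hφ)
  refine hE.mem (g := φ.map (algebraMap K E) - C z) (fun i => ?_) ?_ ?_ ?_
  · rw [coeff_sub, coeff_map, coeff_C, map_sub, ← IsScalarTower.algebraMap_apply]
    refine W.sub_mem (hc i) ?_
    split_ifs
    · exact hrW
    · rw [map_zero]; exact W.zero_mem
  · rw [hlead, ← IsScalarTower.algebraMap_apply, hl]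
  · rw [map_sub, aeval_map_algebraMap, aeval_C, sub_eq_zero]
    rfl
  · rw [derivative_sub, derivative_C, sub_zero, derivative_map, aeval_map_algebraMap, hder]

end Local

/-! ### Local criteria for specializations -/

section LocalSpecialization

variable {K : Type*} [Field K] {φ : K[X]} {t₀ : K}
  {W : ValuationSubring (AlgebraicClosure K)} {E : IntermediateField K (AlgebraicClosure K)}

/-- The point `r` is a zero of `φ - φ(r)` whose multiplicity is a unit, and at which the first nonzero
Taylor coefficient of `φ - φ(r)` is a unit. -/
def IsTameAt (W : ValuationSubring (AlgebraicClosure K)) (φ : K[X]) (r : AlgebraicClosure K) :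
    Prop :=
  ∀ (e : ℕ) (p : (AlgebraicClosure K)[X]), 0 < e →
    φ.map (algebraMap K (AlgebraicClosure K)) - C (aeval r φ) = (X - C r) ^ e * p →
    p.eval r ≠ 0 → W.valuation (p.eval r) = 1 ∧ W.valuation (e : AlgebraicClosure K) = 1

theorem isTameAt_of_derivative {r : AlgebraicClosure K}
    (hr : W.valuation (aeval r (derivative φ)) = 1) : IsTameAt W φ r := by
  intro e p he hfac _
  have hr0 : aeval r (derivative φ) ≠ 0 := fun h => by simp [h] at hr
  have hev : (derivative (φ.map (algebraMap K (AlgebraicClosure K)))).eval r =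
      aeval r (derivative φ) := by rw [derivative_map, eval_map_algebraMap]
  obtain ⟨rfl, hp⟩ := eq_one_of_derivative_ne_zero he hfac (by rwa [hev])
  exact ⟨by rw [hp, hev, hr], by simp⟩

variable [CharZero K]

/-- The Newton–Puiseux recursion runs with constant terms in the backward orbit and leading
coefficients that are units, both inside `E`. -/
theorem GlobalSpecialization.field_le_of_isTameAt (σ : GlobalSpecialization φ t₀)
    (hφ : 0 < φ.natDegree) (hE : IsEtaleClosed W E) (hD : backwardOrbit φ t₀ ⊆ E)
    (htame : ∀ r ∈ backwardOrbit φ t₀, aeval r φ ∈ backwardOrbit φ t₀ → IsTameAt W φ r) :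
    σ.field ≤ E := by
  have ht : algebraMap K (AlgebraicClosure K) t₀ ∈ backwardOrbit φ t₀ :=
    ⟨0, by rw [iter_zero, aeval_X]⟩
  obtain ⟨τ, hτ⟩ := exists_specialization_of_puiseuxClosed (k := E) hφ
    (puiseuxClosed_of_isEtaleClosed hE hD htame) ht (by simp)
  exact σ.field_le E τ hτ

/-- The conditions at the points of the post-critical set under which the specialization at a
post-critical point is unramified. -/
def IsPostCritTame (W : ValuationSubring (AlgebraicClosure K))
    (E : IntermediateField K (AlgebraicClosure K)) (φ : K[X]) : Prop :=
  ∀ r, aeval r φ ∈ postCritSet φ → r ∈ E ∧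
    (r ∈ postCritSet φ ∨ ∀ ν ∈ postCritSet φ, W.valuation (r - ν) = 1) ∧ IsTameAt W φ r

/-- The alternative propagates to preimages. Points away from the post-critical set have all
preimages away from it; a post-critical point has preimages of either kind, controlled by
`IsPostCritTame`. -/
theorem GlobalSpecialization.field_le_of_postCritSet (σ : GlobalSpecialization φ t₀)
    (hφ : 0 < φ.natDegree) (hE : IsEtaleClosed W E)
    (hc : ∀ i, algebraMap K (AlgebraicClosure K) (φ.coeff i) ∈ W)
    (hl : W.valuation (algebraMap K (AlgebraicClosure K) φ.leadingCoeff) = 1)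
    (hd : W.valuation (φ.natDegree : AlgebraicClosure K) = 1)
    (ht : algebraMap K (AlgebraicClosure K) t₀ ∈ W)
    (h : (∀ ν ∈ postCritSet φ, W.valuation (algebraMap K (AlgebraicClosure K) t₀ - ν) = 1) ∨
      (IsPostCritTame W E φ ∧ algebraMap K (AlgebraicClosure K) t₀ ∈ postCritSet φ)) :
    σ.field ≤ E := by
  have step : ∀ r : AlgebraicClosure K, (aeval r φ ∈ W ∧ aeval r φ ∈ E ∧
      ((∀ ν ∈ postCritSet φ, W.valuation (aeval r φ - ν) = 1) ∨
        (IsPostCritTame W E φ ∧ aeval r φ ∈ postCritSet φ))) →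
      (r ∈ W ∧ r ∈ E ∧ ((∀ ν ∈ postCritSet φ, W.valuation (r - ν) = 1) ∨
        (IsPostCritTame W E φ ∧ r ∈ postCritSet φ))) ∧ IsTameAt W φ r := by
    rintro r ⟨hW, hrE, hν | ⟨hS, hP⟩⟩
    · obtain ⟨h1, h2, h3, h4⟩ := preimage_of_valuation_sub_eq_one hE hc hl hd hφ hW hrE hν
      exact ⟨⟨h1, h2, Or.inl h3⟩, isTameAt_of_derivative h4⟩
    · obtain ⟨h1, h2, h3⟩ := hS r hP
      exact ⟨⟨mem_of_aeval_mem hc hl hφ hW, h1, h2.symm.imp id fun h => ⟨hS, h⟩⟩, h3⟩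
  have orbit : ∀ n (r : AlgebraicClosure K),
      aeval r (iter φ n) = algebraMap K (AlgebraicClosure K) t₀ →
      r ∈ W ∧ r ∈ E ∧ ((∀ ν ∈ postCritSet φ, W.valuation (r - ν) = 1) ∨
        (IsPostCritTame W E φ ∧ r ∈ postCritSet φ)) := by
    intro n
    induction n with
    | zero =>
      intro r hr
      rw [iter_zero, aeval_X] at hr
      rw [hr]
      exact ⟨ht, E.algebraMap_mem t₀, h⟩
    | succ n ih =>
      intro r hr
      rw [aeval_iter_succ'] at hr
      exact (step r (ih _ hr)).1
  refine σ.field_le_of_isTameAt hφ hE (fun r ⟨n, hn⟩ => (orbit n r hn).2.1) ?_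
  rintro r - ⟨n, hn⟩
  exact (step r (orbit n _ hn)).2

/-- Specializations of the tower of a linear polynomial lie in étale-closed fields. -/
theorem GlobalSpecialization.field_le_of_natDegree_eq_one (σ : GlobalSpecialization φ t₀)
    (hφ : φ.natDegree = 1) (hE : IsEtaleClosed W E)
    (hl : W.valuation (algebraMap K (AlgebraicClosure K) φ.leadingCoeff) = 1) : σ.field ≤ E := by
  obtain ⟨a, ha, b, rfl⟩ := natDegree_eq_one.1 hφ
  rw [leadingCoeff_linear ha] at hl
  have ha' : algebraMap K (AlgebraicClosure K) a ≠ 0 := by simpa using ha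
  refine σ.field_le_of_isTameAt (by rw [hφ]; exact one_pos) hE ?_ fun r _ _ =>
    isTameAt_of_derivative (by simpa using hl)
  rintro r ⟨n, hn⟩
  induction n generalizing r with
  | zero =>
    rw [iter_zero, aeval_X] at hn
    rw [hn]
    exact E.algebraMap_mem t₀
  | succ n ih =>
    rw [aeval_iter_succ'] at hn
    have h1 := ih hn
    rw [map_add, map_mul, aeval_C, aeval_C, aeval_X] at h1
    have h2 := E.mul_mem (E.inv_mem (E.algebraMap_mem a)) (E.sub_mem h1 (E.algebraMap_mem b))
    rwa [add_sub_cancel_right, inv_mul_cancel_left₀ ha'] at h2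

theorem critPoints_nonempty (hφ : 1 < φ.natDegree) : (critPoints φ).Nonempty := by
  have h1 : ((derivative φ).map (algebraMap K (AlgebraicClosure K))).degree ≠ 0 := by
    rw [degree_map, degree_derivative (by omega)]
    exact_mod_cast (by omega : φ.natDegree - 1 ≠ 0)
  obtain ⟨r, hr⟩ := IsAlgClosed.exists_root _ h1
  rw [IsRoot.def, eval_map_algebraMap] at hr
  exact ⟨r, hr⟩

end LocalSpecialization

/-! ### Ramified places of the specialization -/

section GlobalSpecializationRamification

variable {K : Type*} [Field K] {φ : K[X]} {t₀ : K}

/-- Finiteness lets the conditions of `IsPostCritTame` be imposed pointwise at almost all places. -/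
theorem preimage_postCritSet_finite (hφ : derivative φ ≠ 0) (h : IsPCF φ) :
    {r : AlgebraicClosure K | aeval r φ ∈ postCritSet φ}.Finite := by
  refine Set.Finite.preimage' (f := fun r => aeval r φ) (postCritSet_finite hφ h) fun ν _ => ?_
  have h0 : φ.map (algebraMap K (AlgebraicClosure K)) - C ν ≠ 0 := fun h0 => by
    have := congrArg natDegree h0
    rw [natDegree_sub_C, natDegree_map, natDegree_zero] at this
    exact (natDegree_pos_of_derivative_ne_zero hφ).ne' this
  refine (finite_setOfPred_isRoot h0).subset fun r hr => ?_
  change IsRoot _ r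
  rw [IsRoot.def, eval_sub, eval_C, eval_map_algebraMap, sub_eq_zero]
  exact hr

variable [NumberField K]

/-- The multiplicity and cofactor at `r` are unique, and `e` and `p(r)` are nonzero, hence units at
almost all places. -/
theorem eventually_isTameAt (hφ : 0 < φ.natDegree) (r : AlgebraicClosure K) :
    ∀ᶠ v : HeightOneSpectrum (𝓞 K) in Filter.cofinite,
      ∀ (W : ValuationSubring (AlgebraicClosure K)) [(v.valuation K).HasExtension W.valuation],
        IsTameAt W φ r := by
  classical
  set f := φ.map (algebraMap K (AlgebraicClosure K)) - C (aeval r φ) with hf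
  have hf0 : f ≠ 0 := fun h => by
    have := congrArg natDegree h
    rw [hf, natDegree_sub_C, natDegree_map, natDegree_zero] at this
    omega
  have hroot : f.IsRoot r := by
    rw [IsRoot.def, hf, eval_sub, eval_C, eval_map_algebraMap, sub_self]
  obtain ⟨p, hp, hpr⟩ := exists_eq_pow_rootMultiplicity_mul_and_not_dvd f hf0 r
  rw [dvd_iff_isRoot, IsRoot.def] at hpr
  have hm : (f.rootMultiplicity r : AlgebraicClosure K) ≠ 0 :=
    Nat.cast_ne_zero.2 ((rootMultiplicity_pos hf0).2 hroot).ne'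
  filter_upwards [eventually_valuation_eq_one hpr, eventually_valuation_eq_one hm] with v h1 h2 W _
  intro e q _ hq hqr
  have he : e = f.rootMultiplicity r := by
    have hq0 : q ≠ 0 := fun h => hqr (by rw [h, eval_zero])
    rw [← hf] at hq
    rw [hq, rootMultiplicity_mul (mul_ne_zero (pow_ne_zero _ (X_sub_C_ne_zero r)) hq0),
      rootMultiplicity_X_sub_C_pow, rootMultiplicity_eq_zero hqr, add_zero]
  have hpq : p = q := by
    rw [← hf, he] at hq
    exact mul_left_cancel₀ (pow_ne_zero _ (X_sub_C_ne_zero r)) (hp.symm.trans hq)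
  exact ⟨hpq ▸ h1 W, he ▸ h2 W⟩

/-- At almost all places, the points of the post-critical set and their preimages stay apart. -/
theorem eventually_isPostCritTame (hφ : derivative φ ≠ 0) (h : IsPCF φ) :
    ∀ᶠ v : HeightOneSpectrum (𝓞 K) in Filter.cofinite,
      ∀ (W : ValuationSubring (AlgebraicClosure K)) [(v.valuation K).HasExtension W.valuation]
        (E : IntermediateField K (AlgebraicClosure K)), IsEtaleClosed W E →
        IsPostCritTame W E φ := by
  have h1 : ∀ᶠ v : HeightOneSpectrum (𝓞 K) in Filter.cofinite,
      ∀ r ∈ {r : AlgebraicClosure K | aeval r φ ∈ postCritSet φ},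
      ∀ (W : ValuationSubring (AlgebraicClosure K)) [(v.valuation K).HasExtension W.valuation]
        (E : IntermediateField K (AlgebraicClosure K)), IsEtaleClosed W E →
        r ∈ E ∧ (r ∈ postCritSet φ ∨ ∀ ν ∈ postCritSet φ, W.valuation (r - ν) = 1) ∧
          IsTameAt W φ r := by
    refine (Filter.eventually_all_finite (preimage_postCritSet_finite hφ h)).2 fun r _ => ?_
    by_cases hr : r ∈ postCritSet φ
    · filter_upwards [eventually_mem_isEtaleClosed r,
        eventually_isTameAt (natDegree_pos_of_derivative_ne_zero hφ) r] with v h1 h2 W _ E hE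
      exact ⟨h1 W E hE, Or.inl hr, h2 W⟩
    · have h3 := (Filter.eventually_all_finite (postCritSet_finite hφ h)).2 fun ν hν =>
        eventually_valuation_eq_one (K := K) (sub_ne_zero.2 fun h : r = ν => hr (h ▸ hν))
      filter_upwards [eventually_mem_isEtaleClosed r,
        eventually_isTameAt (natDegree_pos_of_derivative_ne_zero hφ) r, h3] with v h1 h2 h3 W _ E hE
      exact ⟨h1 W E hE, Or.inr fun ν hν => h3 ν hν W, h2 W⟩
  filter_upwards [h1] with v hv W _ E hE r hr
  exact hv r hr W E hE

theorem eventually_coeff_mem (φ : K[X]) :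
    ∀ᶠ v : HeightOneSpectrum (𝓞 K) in Filter.cofinite,
      ∀ (W : ValuationSubring (AlgebraicClosure K)) [(v.valuation K).HasExtension W.valuation] (i),
        algebraMap K (AlgebraicClosure K) (φ.coeff i) ∈ W := by
  have h1 := (Filter.eventually_all_finset φ.support).2 fun i _ =>
    eventually_mem (algebraMap K (AlgebraicClosure K) (φ.coeff i))
  filter_upwards [h1] with v hv W _ i
  by_cases hi : i ∈ φ.support
  · exact hv i hi W
  · rw [notMem_support_iff.1 hi, map_zero]
    exact W.zero_mem

/-- Specializations of the tower of a post-critically finite polynomial are unramified at almost all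
places. -/
theorem GlobalSpecialization.eventually_unramifiedIn (σ : GlobalSpecialization φ t₀)
    (hφ : derivative φ ≠ 0) (h : IsPCF φ) :
    ∀ᶠ v : HeightOneSpectrum (𝓞 K) in Filter.cofinite, UnramifiedIn (v.valuation K) σ.field := by
  have hdeg := natDegree_pos_of_derivative_ne_zero hφ
  have hφ0 : φ ≠ 0 := ne_zero_of_natDegree_gt hdeg
  have hl : algebraMap K (AlgebraicClosure K) φ.leadingCoeff ≠ 0 := by simpa using hφ0
  have hd : (φ.natDegree : AlgebraicClosure K) ≠ 0 := Nat.cast_ne_zero.2 hdeg.ne'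
  have ht : ∀ᶠ v : HeightOneSpectrum (𝓞 K) in Filter.cofinite,
      ∀ (W : ValuationSubring (AlgebraicClosure K)) [(v.valuation K).HasExtension W.valuation]
        (E : IntermediateField K (AlgebraicClosure K)), IsEtaleClosed W E →
        (∀ ν ∈ postCritSet φ, W.valuation (algebraMap K (AlgebraicClosure K) t₀ - ν) = 1) ∨
          (IsPostCritTame W E φ ∧ algebraMap K (AlgebraicClosure K) t₀ ∈ postCritSet φ) := by
    by_cases htP : algebraMap K (AlgebraicClosure K) t₀ ∈ postCritSet φ
    · filter_upwards [eventually_isPostCritTame hφ h] with v hv W _ E hE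
      exact Or.inr ⟨hv W E hE, htP⟩
    · have h3 := (Filter.eventually_all_finite (postCritSet_finite hφ h)).2 fun ν hν =>
        eventually_valuation_eq_one (K := K)
          (z := algebraMap K (AlgebraicClosure K) t₀ - ν) (sub_ne_zero.2 fun h' => htP (by rw [h']; exact hν))
      filter_upwards [h3] with v hv W _ E hE
      exact Or.inl fun ν hν => hv ν hν W
  filter_upwards [eventually_coeff_mem φ, eventually_valuation_eq_one hl,
    eventually_valuation_eq_one hd, eventually_mem (algebraMap K (AlgebraicClosure K) t₀), ht]
    with v h1 h2 h3 h4 h5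
  exact unramifiedIn_of_le v _ fun W _ E hE =>
    σ.field_le_of_postCritSet hdeg hE (h1 W) (h2 W) (h3 W) (h4 W) (h5 W E hE)

theorem GlobalSpecialization.ramifiedPlaces_finite (σ : GlobalSpecialization φ t₀)
    (hφ : derivative φ ≠ 0) (h : IsPCF φ) : (ramifiedPlaces K σ.field).Finite := by
  have h1 : {v : HeightOneSpectrum (𝓞 K) | ¬ UnramifiedIn (v.valuation K) σ.field}.Finite :=
    σ.eventually_unramifiedIn hφ h
  refine ((h1.image Sum.inl).union (Set.finite_range Sum.inr)).subset ?_
  rintro (v | w) hp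
  · exact Or.inl ⟨v, hp, rfl⟩
  · exact Or.inr ⟨w, rfl⟩

theorem coeff_mem_of_isIntegral (v : HeightOneSpectrum (𝓞 K))
    (W : ValuationSubring (AlgebraicClosure K)) [(v.valuation K).HasExtension W.valuation] {a : K}
    (ha : IsIntegral ℤ a) : algebraMap K (AlgebraicClosure K) a ∈ W := by
  rw [← W.valuation_le_one_iff, Valuation.HasExtension.val_map_le_one_iff (v.valuation K)]
  exact v.valuation_le_one (K := K) (⟨a, ha⟩ : 𝓞 K)

/-- Specializations are unramified away from the degree, the leading coefficient, the differences
of `t₀` and the post-critical points, and the real places. -/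
theorem GlobalSpecialization.ramifiedPlaces_subset (σ : GlobalSpecialization φ t₀)
    (hφ : 0 < φ.natDegree) (hint : ∀ i, IsIntegral ℤ (φ.coeff i)) :
    ramifiedPlaces K σ.field ⊆ ramSet φ t₀ := by
  rintro (v | w) hp
  · by_contra hv
    change ¬ (_ ∨ _ ∨ _) at hv
    push Not at hv
    obtain ⟨hd, hl, ht⟩ := hv
    refine hp (unramifiedIn_of_le v _ fun W hW E hE => ?_)
    have hl' : W.valuation (algebraMap K (AlgebraicClosure K) φ.leadingCoeff) = 1 :=
      (Valuation.HasExtension.val_map_eq_one_iff (v.valuation K) W.valuation _).2 hl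
    have hd' : W.valuation (φ.natDegree : AlgebraicClosure K) = 1 := by
      rw [← map_natCast (algebraMap K (AlgebraicClosure K))]
      exact (Valuation.HasExtension.val_map_eq_one_iff (v.valuation K) W.valuation _).2 hd
    have hc := fun i => coeff_mem_of_isIntegral v W (hint i)
    have hν := fun ν hν => ht ν hν W hW
    -- In degree one there is no critical point, so integrality of `t₀` cannot be deduced. In higher
    -- degree it follows from that of a critical point `r`, as `t₀ - r` is a unit.
    rcases (Nat.succ_le_of_lt hφ).eq_or_lt with h1 | h1
    · exact σ.field_le_of_natDegree_eq_one h1.symm hE hl'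
    · obtain ⟨r, hr⟩ := critPoints_nonempty h1
      have hr' := critPoints_subset_postCritSet hr
      refine σ.field_le_of_postCritSet hφ hE hc hl' hd' ?_ (Or.inl hν)
      have := W.add_mem _ _ ((W.valuation_le_one_iff _).1 (hν r hr').le)
        (postCritSet_subset hc hl' hd' hr')
      rwa [sub_add_cancel] at this
  · change w.IsReal
    by_contra hw
    rw [InfinitePlace.not_isReal_iff_isComplex] at hw
    exact hp fun u hu => InfinitePlace.isUnramified_iff.2 (Or.inr (by rwa [hu]))

theorem ramSet_finite (hφ : derivative φ ≠ 0) (h : IsPCF φ)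
    (ht : algebraMap K (AlgebraicClosure K) t₀ ∉ postCritSet φ) : (ramSet φ t₀).Finite := by
  have hdeg := natDegree_pos_of_derivative_ne_zero hφ
  have key : ∀ x : K, x ≠ 0 →
      ∀ᶠ v : HeightOneSpectrum (𝓞 K) in Filter.cofinite, v.valuation K x = 1 := by
    intro x hx
    filter_upwards [eventually_valuation_eq_one
      (K := K) (z := algebraMap K (AlgebraicClosure K) x) (by simpa using hx)] with v hv
    -- One extension of `v` exists, and through it the statement about all extensions descends to
    -- `v`.
    obtain ⟨W, hW⟩ := exists_comap_eq (L := AlgebraicClosure K) (v.valuation K).valuationSubring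
    have : (v.valuation K).HasExtension W.valuation := hasExtension_of_comap_eq hW
    exact (Valuation.HasExtension.val_map_eq_one_iff (v.valuation K) W.valuation _).1 (hv W)
  have h3 := (Filter.eventually_all_finite (postCritSet_finite hφ h)).2 fun ν hν =>
    eventually_valuation_eq_one (K := K)
          (z := algebraMap K (AlgebraicClosure K) t₀ - ν) (sub_ne_zero.2 fun h' => ht (by rw [h']; exact hν))
  have h1 : ∀ᶠ v : HeightOneSpectrum (𝓞 K) in Filter.cofinite, Sum.inl v ∉ ramSet φ t₀ := by
    filter_upwards [key _ (Nat.cast_ne_zero.2 hdeg.ne'),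
      key _ (leadingCoeff_ne_zero.2 (ne_zero_of_natDegree_gt hdeg)), h3] with v hd hl ht
    rintro (h | h | ⟨ν, hν, W, hW, hne⟩)
    · exact h hd
    · exact h hl
    · exact hne (ht ν hν W)
  have h2 : {v : HeightOneSpectrum (𝓞 K) | ¬ Sum.inl v ∉ ramSet φ t₀}.Finite := h1
  refine ((h2.image Sum.inl).union (Set.finite_range Sum.inr)).subset ?_
  rintro (v | w) hp
  · exact Or.inl ⟨v, not_not.2 hp, rfl⟩
  · exact Or.inr ⟨w, rfl⟩

end GlobalSpecializationRamification

end IteratedTower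

/-! ### Assembly of both parts -/

theorem theorem1 :
    (∀ (K : Type*) [Field K] [PerfectField K] (φ : K[X]), derivative φ ≠ 0 →
      (IteratedTower.FinitelyRamifiedOverRat K (IteratedTower.towerField φ) ↔
        IteratedTower.IsPCF φ)) ∧
    (∀ (K : Type*) [Field K] [NumberField K] (φ : K[X]), 1 ≤ φ.natDegree →
      IteratedTower.IsPCF φ →
      ∀ (t₀ : K) (σ : IteratedTower.GlobalSpecialization φ t₀),
        (IteratedTower.ramifiedPlaces K σ.field).Finite ∧
        ((∀ i, IsIntegral ℤ (φ.coeff i)) →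
          IteratedTower.ramifiedPlaces K σ.field ⊆ IteratedTower.ramSet φ t₀ ∧
          (algebraMap K (AlgebraicClosure K) t₀ ∉ IteratedTower.postCritSet φ →
            (IteratedTower.ramSet φ t₀).Finite))) := by
  refine ⟨fun K _ _ φ hφ => ⟨IteratedTower.isPCF_of_finitelyRamified hφ,
    IteratedTower.finitelyRamified_of_isPCF hφ⟩, fun K _ _ φ hd h t₀ σ => ?_⟩
  have hφ : derivative φ ≠ 0 := fun h0 => by
    have := degree_derivative (p := φ) (by omega)
    rw [h0, degree_zero] at this
    exact absurd this (by simp)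
  exact ⟨σ.ramifiedPlaces_finite hφ h, fun hint =>
    ⟨σ.ramifiedPlaces_subset hd hint, IteratedTower.ramSet_finite hφ h⟩⟩
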